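/- **Theorem (Fast rate).** There is a universal constant $C>0$ such that the following holds. Let $\mathcal X$ be a measurable space and let $P_1,P_2,\dots$ be probability distributions of pairs $(x,y)\in\mathcal X\times\mathbb R$ such that, for some $M_0>0$, $|y|\le M_0$ almost surely under every $P_j$, and such that all $P_j$ have the same marginal distribution $\mathcal P$ of the covariate $x$. Let $f_1,f_2:\mathcal X\to\mathbb R$ be measurable with $|f_1|,|f_2|\le M_0$. Let $t\ge1$ and let $B_1,B_2,\dots\ge1$ be integers. One observes independent samples $z_{j,i}\sim P_j$, $1\le j\le t$, $1\le i\le B_j$. Let $\ell(f,(x,y))=(f(x)-y)^2$ and $L_t(f)=\mathbb E_{z\sim P_t}\,\ell(f,z)$; let $f_j^*(x)=\mathbb E[y\mid x]$ be the regression function of $P_j$, let $\|h\|_{\mathcal P}=(\mathbb E_{x\sim\mathcal P}h(x)^2)^{1/2}$, and let $B_{t,k}=\sum_{j=t-k+1}^tB_j$. *Algorithm (pairwise comparison with adaptive rolling window; hyperparameters $\delta'$ and $M$).* Put $u_{j,i}=\ell(f_1,z_{j,i})-\ell(f_2,z_{j,i})$ and, for $1\le k\le t$, $$\widehat\mu_{t,k}=\frac1{B_{t,k}}\sum_{j=t-k+1}^t\sum_{i=1}^{B_j}u_{j,i},\qquad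 \widehat v_{t,k}^2=\frac1{B_{t,k}-1}\sum_{j=t-k+1}^t\sum_{i=1}^{B_j}(u_{j,i}-\widehat\mu_{t,k})^2 ,$$ $$\widehat\psi(k)=\begin{cases}M,&B_{t,k}=1,\\ \widehat v_{t,k}\sqrt{\dfrac{2\log(2/\delta')}{B_{t,k}}}+\dfrac{8M\log(2/\delta')}{3(B_{t,k}-1)},&B_{t,k}\ge2,\end{cases}$$ $$\widehat\phi(k)=\max_{1\le i\le k}\big(|\widehat\mu_{t,k}-\widehat\mu_{t,i}|-[\widehat\psi(k)+\widehat\psi(i)]\big)_+ .$$ Choose any $\widehat k$ minimizing $\widehat\phi(k)+\widehat\psi(k)$ over $1\le k\le t$; output $\widehat f=f_1$ if $\widehat\mu_{t,\widehat k}\le0$ and $\widehat f=f_2$ otherwise. Let $\delta\in(0,1)$ and run the algorithm with $\delta'=\delta/(3t)$ and $M=8M_0^2$ (the length of the interval $[-4M_0^2,4M_0^2]$ that contains the $u_{j,i}$). Then, with probability at least $1-\delta$, for every admissible choice of $\widehat k$, $$\|\widehat f-f_t^*\|_{\mathcal P}-\min_{r\in\{1,2\}}\|f_r-f_t^*\|_{\mathcal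 P}\le C\sqrt{\log(6t/\delta)}\,\min_{1\le k\le t}\Big\{\max_{t-k+1\le j\le t}\|f_j^*-f_t^*\|_{\mathcal P}+\frac{M_0}{\sqrt{B_{t,k}}}\Big\}$$ and, on the same event, the excess risk satisfies $$L_t(\widehat f)-L_t(f_t^*)\le 2\min_{r\in\{1,2\}}\big[L_t(f_r)-L_t(f_t^*)\big]+C\log(6t/\delta)\min_{1\le k\le t}\Big\{\max_{t-k+1\le j\le t}\|f_j^*-f_t^*\|_{\mathcal P}^2+\frac{M_0^2}{B_{t,k}}\Big\}.$$ -/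

import Mathlib

open MeasureTheory ProbabilityTheory

noncomputable section

namespace RollingWindow

/-! ### Adaptive rolling window for mean estimation

The data `u j i` are indexed by the period `j ∈ {1, …, t}` and the sample index
`i ∈ {1, …, B j}`, where `B j` is the batch size. The window of length `k ∈ {1, …, t}` consists of
the periods `t - k + 1, …, t`. -/

/-- `B_{t,k}`: the number of samples in the `k` most recent periods. -/
def windowSize (B : ℕ → ℕ) (t k : ℕ) : ℕ :=
  ∑ j ∈ Finset.Icc (t - k + 1) t, B j

/-- `μ̂_{t,k}`: the sample mean over the window. -/
def windowMean (B : ℕ → ℕ) (u : ℕ → ℕ → ℝ) (t k : ℕ) : ℝ :=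
  (∑ j ∈ Finset.Icc (t - k + 1) t, ∑ i ∈ Finset.Icc 1 (B j), u j i) / (windowSize B t k : ℝ)

/-- `v̂²_{t,k}`: the sample variance over the window (only used when `B_{t,k} ≥ 2`). -/
def windowVar (B : ℕ → ℕ) (u : ℕ → ℕ → ℝ) (t k : ℕ) : ℝ :=
  (∑ j ∈ Finset.Icc (t - k + 1) t, ∑ i ∈ Finset.Icc 1 (B j), (u j i - windowMean B u t k) ^ 2) /
    ((windowSize B t k : ℝ) - 1)

/-- `ψ̂(t,k,δ)`: the empirical proxy for the stochastic error. -/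
def psiHat (B : ℕ → ℕ) (u : ℕ → ℕ → ℝ) (M δ : ℝ) (t k : ℕ) : ℝ :=
  if windowSize B t k = 1 then M
  else √(windowVar B u t k) * √(2 * Real.log (2 / δ) / (windowSize B t k : ℝ)) +
    8 * M * Real.log (2 / δ) / (3 * ((windowSize B t k : ℝ) - 1))

/-- `φ̂(t,k,δ)`: the empirical proxy for the bias, a maximum over `i ∈ {1, …, k}` of positive
parts. -/
def phiHat (B : ℕ → ℕ) (u : ℕ → ℕ → ℝ) (M δ : ℝ) (t k : ℕ) : ℝ :=
  ⨆ i : Set.Icc 1 k,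
    max (|windowMean B u t k - windowMean B u t i| - (psiHat B u M δ t k + psiHat B u M δ t i)) 0

/-- `k` is a window that the mean estimation algorithm may choose: a minimizer of
`φ̂(t,k,δ) + ψ̂(t,k,δ)` over `k ∈ {1, …, t}`. -/
def IsAdaptiveWindow (B : ℕ → ℕ) (u : ℕ → ℕ → ℝ) (M δ : ℝ) (t k : ℕ) : Prop :=
  k ∈ Set.Icc 1 t ∧ ∀ k' ∈ Set.Icc 1 t,
    phiHat B u M δ t k + psiHat B u M δ t k ≤ phiHat B u M δ t k' + psiHat B u M δ t k'

/-! ### Regression with square loss and model comparison -/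

variable {X : Type*}

/-- The square loss `ℓ(f,(x,y)) = (f x - y)²`. -/
def sqLoss (f : X → ℝ) (z : X × ℝ) : ℝ := (f z.1 - z.2) ^ 2

/-- `fhat` is a possible output of the pairwise comparison algorithm on the models `f₁`, `f₂`, the
data `z j i` and hyperparameters `δ`, `M`: the mean estimation algorithm is run on the loss
differences, with any admissible choice of the window, and `f₁` is returned if the estimate is
nonpositive, `f₂` otherwise. -/
def IsComparisonOutput (f₁ f₂ : X → ℝ) (B : ℕ → ℕ) (z : ℕ → ℕ → X × ℝ) (M δ : ℝ) (t : ℕ)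
    (fhat : X → ℝ) : Prop :=
  ∃ k, IsAdaptiveWindow B (fun j i => sqLoss f₁ (z j i) - sqLoss f₂ (z j i)) M δ t k ∧
    ((windowMean B (fun j i => sqLoss f₁ (z j i) - sqLoss f₂ (z j i)) t k ≤ 0 ∧ fhat = f₁) ∨
      (0 < windowMean B (fun j i => sqLoss f₁ (z j i) - sqLoss f₂ (z j i)) t k ∧ fhat = f₂))

variable [MeasurableSpace X]

/-- The risk (generalization error) of `f` under the distribution `P`, for the square loss. -/
def risk (P : Measure (X × ℝ)) (f : X → ℝ) : ℝ := ∫ z, sqLoss f z ∂P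

/-- The regression function `x ↦ 𝔼[y | x]` of a distribution `P` of `(x, y)`: the mean of the
regular conditional distribution of `y` given `x`. -/
def regressionFn (P : Measure (X × ℝ)) [IsFiniteMeasure P] (x : X) : ℝ := ∫ y, y ∂(P.condKernel x)

/-- The `L²` norm `‖h‖_Q = (𝔼_{x ∼ Q} h(x)²)^{1/2}`. -/
def normL2 (Q : Measure X) (h : X → ℝ) : ℝ := √(∫ x, h x * h x ∂Q)

/-- The distribution shift `max_{t-k+1 ≤ j ≤ t} ‖f_j^* - f_t^*‖_Q` over the window of length `k`,
where `f_j^*` is the regression function of `P j`. -/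
def maxShift (P : ℕ → Measure (X × ℝ)) [∀ j, IsProbabilityMeasure (P j)] (Q : Measure X)
    (t k : ℕ) : ℝ :=
  ⨆ j : Set.Icc (t - k + 1) t, normL2 Q (fun x => regressionFn (P j) x - regressionFn (P t) x)

end RollingWindow

end

/-!
Bernstein's inequality involves the variance of the observations. By exponential tail bounds for
their squares and Hoeffding's inequality for the sample mean, the sample variance is comparable to
the variance up to terms of order `log (6 t / δ) / n` for a window of size `n`. So with high
probability `psiHat` bounds the statistical error of every window and is itself bounded by a
deterministic quantity.

Write `H = ‖f₁ - f₂‖`, `d r = ‖f r - f*_t‖`, and let `A` be the shift over a window of length `k`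
and size `n`. The loss differences have second moment at most `(4 M₀ H)²`, and by polarization the
bias of the window is at most `2 H A`. Both error terms are thus proportional to `H ≤ d 1 + d 2`, up
to a term of squared order. The selected window pays only a constant factor over any fixed `k`, so
it estimates `d 1 ² - d 2 ²` within `(d 1 + d 2) ρ + σ²`, where `ρ` and `σ` are multiples of
`A + M₀ √(log (6 t / δ) / n)`. If the sign of that estimate selects the model at distance `d` over
the one at distance `e`, then `d² - e² ≤ (d + e) ρ + σ²`, which forces `d - e ≤ ρ + σ`: dividing by
`d + e` is what turns a bound on squared distances into the fast rate.
-/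

namespace RollingWindow

section ExpBounds

lemma hasSum_exp_sub_one_sub_id (x : ℝ) :
    HasSum (fun n : ℕ => x ^ (n + 2) / ((n + 2).factorial : ℝ)) (Real.exp x - 1 - x) := by
  have hexp := NormedSpace.expSeries_div_hasSum_exp x
  rw [← Real.exp_eq_exp_ℝ] at hexp
  simpa [Finset.sum_range_succ, sub_sub] using (hasSum_nat_add_iff' 2).2 hexp

lemma exp_mul_le_one_add_mul_add_sq_mul {l x : ℝ} (hl : 0 ≤ l) (hx : |x| ≤ 1) :
    Real.exp (l * x) ≤ 1 + l * x + x ^ 2 * (Real.exp l - 1 - l) := by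
  have hterm (n : ℕ) : (l * x) ^ (n + 2) / ((n + 2).factorial : ℝ) ≤
      x ^ 2 * (l ^ (n + 2) / ((n + 2).factorial : ℝ)) := by
    have hxn : x ^ n ≤ 1 :=
      (le_abs_self _).trans ((abs_pow x n).trans_le (pow_le_one₀ (abs_nonneg _) hx))
    rw [← mul_div_assoc]
    gcongr
    calc (l * x) ^ (n + 2) = l ^ (n + 2) * x ^ 2 * x ^ n := by ring
      _ ≤ l ^ (n + 2) * x ^ 2 * 1 := by gcongr
      _ = x ^ 2 * l ^ (n + 2) := by ring
  have := hasSum_le hterm (hasSum_exp_sub_one_sub_id (l * x))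
    ((hasSum_exp_sub_one_sub_id l).mul_left (x ^ 2))
  linarith

lemma two_mul_three_pow_le_factorial (n : ℕ) : 2 * 3 ^ n ≤ (n + 2).factorial := by
  induction n with
  | zero => decide
  | succ n ih =>
    rw [show n + 1 + 2 = (n + 2) + 1 by ring, Nat.factorial_succ, pow_succ]
    nlinarith

lemma exp_sub_one_sub_id_le {l : ℝ} (hl : 0 ≤ l) (hl3 : l < 3) :
    Real.exp l - 1 - l ≤ l ^ 2 / (2 * (1 - l / 3)) := by
  have hgeom : HasSum (fun n : ℕ => l ^ 2 / 2 * (l / 3) ^ n) (l ^ 2 / 2 * (1 - l / 3)⁻¹) :=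
    (hasSum_geometric_of_lt_one (by positivity) (by linarith)).mul_left _
  have hterm (n : ℕ) : l ^ (n + 2) / ((n + 2).factorial : ℝ) ≤ l ^ 2 / 2 * (l / 3) ^ n :=
    calc l ^ (n + 2) / ((n + 2).factorial : ℝ) ≤ l ^ (n + 2) / (2 * 3 ^ n : ℝ) := by
          gcongr
          exact_mod_cast two_mul_three_pow_le_factorial n
      _ = l ^ 2 / 2 * (l / 3) ^ n := by rw [div_pow, pow_add]; field_simp
  calc Real.exp l - 1 - l ≤ l ^ 2 / 2 * (1 - l / 3)⁻¹ :=
        hasSum_le hterm (hasSum_exp_sub_one_sub_id l) hgeom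
    _ = l ^ 2 / (2 * (1 - l / 3)) := by rw [← div_eq_mul_inv, div_div]

lemma exp_mul_le_one_add_mul_exp_sub_one (l : ℝ) {x : ℝ} (hx : x ∈ Set.Icc (0 : ℝ) 1) :
    Real.exp (l * x) ≤ 1 + x * (Real.exp l - 1) := by
  have h := convexOn_exp.2 (Set.mem_univ l) (Set.mem_univ 0) hx.1 (sub_nonneg.2 hx.2) (by ring)
  simp only [smul_eq_mul, mul_zero, add_zero, Real.exp_zero] at h
  rw [mul_comm l x]
  linarith

lemma exp_neg_le_one_sub_add_sq_sub_cube {l : ℝ} (hl : l ∈ Set.Icc (0 : ℝ) 1) :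
    Real.exp (-l) ≤ 1 - l + l ^ 2 / 2 - l ^ 3 / 18 := by
  have habs : |-l| = l := by rw [abs_neg, abs_of_nonneg hl.1]
  have htaylor := (abs_le.1 (Real.exp_bound (habs.trans_le hl.2) (n := 4) (by norm_num))).2
  rw [habs] at htaylor
  norm_num [Finset.sum_range_succ, Nat.factorial] at htaylor
  have hquartic : l ^ 4 ≤ l ^ 3 := pow_le_pow_of_le_one hl.1 hl.2 (by norm_num)
  have hcube : 0 ≤ l ^ 3 := pow_nonneg hl.1 3
  linarith

end ExpBounds

section Concentration

variable {Ω κ : Type*} [MeasurableSpace Ω] {μ : Measure Ω} [Fintype κ] {Y : κ → Ω → ℝ}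
  {c : κ → ℝ} {l x : ℝ}

lemma mgf_sum_le_exp_sum (hm : ∀ i, Measurable (Y i)) (hind : iIndepFun Y μ)
    (hc : ∀ i, mgf (Y i) μ l ≤ Real.exp (c i)) :
    mgf (∑ i, Y i) μ l ≤ Real.exp (∑ i, c i) := by
  rw [hind.mgf_sum hm, Real.exp_sum]
  exact Finset.prod_le_prod (fun i _ => mgf_nonneg) fun i _ => hc i

lemma measureReal_le_sum_le_exp [IsFiniteMeasure μ] (hm : ∀ i, Measurable (Y i))
    (hind : iIndepFun Y μ) (hint : ∀ i, Integrable (fun ω => Real.exp (l * Y i ω)) μ)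
    (hl : 0 ≤ l) (hc : ∀ i, mgf (Y i) μ l ≤ Real.exp (c i)) (ε : ℝ) :
    μ.real {ω | ε ≤ ∑ i, Y i ω} ≤ Real.exp (-l * ε + ∑ i, c i) := by
  have hmarkov := measure_ge_le_exp_mul_mgf ε hl
    (hind.integrable_exp_mul_sum hm (s := Finset.univ) fun i _ => hint i)
  simp only [Finset.sum_apply] at hmarkov
  refine hmarkov.trans ?_
  rw [Real.exp_add]
  gcongr
  exact mgf_sum_le_exp_sum hm hind hc

lemma measureReal_sum_le_le_exp [IsFiniteMeasure μ] (hm : ∀ i, Measurable (Y i))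
    (hind : iIndepFun Y μ) (hint : ∀ i, Integrable (fun ω => Real.exp (l * Y i ω)) μ)
    (hl : l ≤ 0) (hc : ∀ i, mgf (Y i) μ l ≤ Real.exp (c i)) (ε : ℝ) :
    μ.real {ω | ∑ i, Y i ω ≤ ε} ≤ Real.exp (-l * ε + ∑ i, c i) := by
  have hmarkov := measure_le_le_exp_mul_mgf ε hl
    (hind.integrable_exp_mul_sum hm (s := Finset.univ) fun i _ => hint i)
  simp only [Finset.sum_apply] at hmarkov
  refine hmarkov.trans ?_
  rw [Real.exp_add]
  gcongr
  exact mgf_sum_le_exp_sum hm hind hc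

variable [IsProbabilityMeasure μ]

lemma mgf_le_exp_of_abs_le_one {Z : Ω → ℝ} (hm : AEMeasurable Z μ) (hb : ∀ᵐ ω ∂μ, |Z ω| ≤ 1)
    (hl : 0 ≤ l) :
    mgf Z μ l ≤ Real.exp (l * ∫ ω, Z ω ∂μ + (∫ ω, Z ω ^ 2 ∂μ) * (Real.exp l - 1 - l)) := by
  have hZ : Integrable Z μ := .of_bound hm.aestronglyMeasurable 1 hb
  have hZ2 : Integrable (fun ω => Z ω ^ 2) μ := by
    refine .of_bound (hm.pow_const 2).aestronglyMeasurable 1 ?_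
    filter_upwards [hb] with ω hω
    rw [Real.norm_eq_abs, abs_pow]
    exact pow_le_one₀ (abs_nonneg _) hω
  have hlin : Integrable (fun ω => 1 + l * Z ω) μ := (integrable_const _).add (hZ.const_mul _)
  calc mgf Z μ l ≤ ∫ ω, (1 + l * Z ω + Z ω ^ 2 * (Real.exp l - 1 - l)) ∂μ := by
        refine integral_mono_ae (integrable_exp_mul_of_mem_Icc hm (hb.mono fun _ => abs_le.1))
          (hlin.add (hZ2.mul_const _)) ?_
        filter_upwards [hb] with ω hω using exp_mul_le_one_add_mul_add_sq_mul hl hω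
    _ = l * ∫ ω, Z ω ∂μ + (∫ ω, Z ω ^ 2 ∂μ) * (Real.exp l - 1 - l) + 1 := by
        rw [integral_add hlin (hZ2.mul_const _),
          integral_add (integrable_const _) (hZ.const_mul _), integral_const_mul,
          integral_mul_const, integral_const, probReal_univ, one_smul]
        ring
    _ ≤ _ := Real.add_one_le_exp _

lemma mgf_le_exp_of_mem_Icc {Z : Ω → ℝ} (hm : AEMeasurable Z μ)
    (hb : ∀ᵐ ω ∂μ, Z ω ∈ Set.Icc (0 : ℝ) 1) (l : ℝ) :
    mgf Z μ l ≤ Real.exp ((∫ ω, Z ω ∂μ) * (Real.exp l - 1)) := by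
  have hZ : Integrable Z μ := .of_mem_Icc 0 1 hm hb
  calc mgf Z μ l ≤ ∫ ω, (1 + Z ω * (Real.exp l - 1)) ∂μ := by
        refine integral_mono_ae (integrable_exp_mul_of_mem_Icc hm hb)
          ((integrable_const _).add (hZ.mul_const _)) ?_
        filter_upwards [hb] with ω hω using exp_mul_le_one_add_mul_exp_sub_one l hω
    _ = (∫ ω, Z ω ∂μ) * (Real.exp l - 1) + 1 := by
        rw [integral_add (integrable_const _) (hZ.mul_const _), integral_mul_const,
          integral_const, probReal_univ, one_smul, add_comm]
    _ ≤ _ := Real.add_one_le_exp _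

lemma mul_exp_sub_one_sub_id_sub_le {q s : ℝ} (hq : 0 < q) (hs : 0 ≤ s) :
    s ^ 2 * (Real.exp (q / (s + q / 3)) - 1 - q / (s + q / 3)) -
      q / (s + q / 3) * (q * s + q ^ 2 / 6) ≤ -(q ^ 2 / 2) := by
  have hd : 0 < s + q / 3 := by positivity
  rcases hs.eq_or_lt with rfl | hs
  · field_simp
    norm_num
    linarith
  have hl3 : q / (s + q / 3) < 3 := by
    rw [div_lt_iff₀ hd]
    linarith
  have hone_sub : 1 - q / (s + q / 3) / 3 = s / (s + q / 3) := by
    field_simp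
    ring
  calc s ^ 2 * (Real.exp (q / (s + q / 3)) - 1 - q / (s + q / 3)) -
        q / (s + q / 3) * (q * s + q ^ 2 / 6)
      ≤ s ^ 2 * ((q / (s + q / 3)) ^ 2 / (2 * (1 - q / (s + q / 3) / 3))) -
        q / (s + q / 3) * (q * s + q ^ 2 / 6) := by
        gcongr
        exact exp_sub_one_sub_id_le (by positivity) hl3
    _ = -(q ^ 2 / 2) := by
        rw [hone_sub]
        field_simp
        ring

theorem measureReal_bernstein_le_sum_le (hm : ∀ i, Measurable (Y i)) (hind : iIndepFun Y μ)
    (hb : ∀ i, ∀ᵐ ω ∂μ, |Y i ω| ≤ 1) (h0 : ∑ i, ∫ ω, Y i ω ∂μ = 0) (hx : 0 < x) :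
    μ.real {ω | √(2 * x) * √(∑ i, ∫ ω, Y i ω ^ 2 ∂μ) + x / 3 ≤ ∑ i, Y i ω} ≤ Real.exp (-x) := by
  set q := √(2 * x)
  set s := √(∑ i, ∫ ω, Y i ω ^ 2 ∂μ)
  have hq : q ^ 2 = 2 * x := Real.sq_sqrt (by positivity)
  have hs : s ^ 2 = ∑ i, ∫ ω, Y i ω ^ 2 ∂μ :=
    Real.sq_sqrt (Finset.sum_nonneg fun i _ => integral_nonneg fun ω => sq_nonneg _)
  have hq0 : 0 < q := Real.sqrt_pos.2 (by positivity)
  have hs0 : 0 ≤ s := Real.sqrt_nonneg _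
  set l := q / (s + q / 3)
  have hl0 : 0 ≤ l := by positivity
  have hchernoff := measureReal_le_sum_le_exp hm hind
    (fun i => integrable_exp_mul_of_mem_Icc (hm i).aemeasurable ((hb i).mono fun _ => abs_le.1)) hl0
    (fun i => mgf_le_exp_of_abs_le_one (hm i).aemeasurable (hb i) hl0) (q * s + x / 3)
  refine hchernoff.trans (Real.exp_le_exp.2 ?_)
  rw [Finset.sum_add_distrib, ← Finset.mul_sum, ← Finset.sum_mul, h0, ← hs]
  have := mul_exp_sub_one_sub_id_sub_le hq0 hs0
  rw [show x / 3 = q ^ 2 / 6 by linarith]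
  linarith

theorem measureReal_bernstein_le_abs_sum_le (hm : ∀ i, Measurable (Y i)) (hind : iIndepFun Y μ)
    (hb : ∀ i, ∀ᵐ ω ∂μ, |Y i ω| ≤ 1) (h0 : ∑ i, ∫ ω, Y i ω ∂μ = 0) (hx : 0 < x) :
    μ.real {ω | √(2 * x) * √(∑ i, ∫ ω, Y i ω ^ 2 ∂μ) + x / 3 ≤ |∑ i, Y i ω|} ≤
      2 * Real.exp (-x) := by
  have hupper := measureReal_bernstein_le_sum_le hm hind hb h0 hx
  have hlower := measureReal_bernstein_le_sum_le (Y := fun i ω => -Y i ω) (fun i => (hm i).neg)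
    (hind.comp _ fun _ => measurable_neg) (by simpa only [abs_neg] using hb)
    (by simp only [integral_neg, Finset.sum_neg_distrib, h0, neg_zero]) hx
  simp only [neg_sq, Finset.sum_neg_distrib] at hlower
  simp only [le_abs, Set.ofPred_or]
  exact (measureReal_union_le _ _).trans (by linarith)

theorem measureReal_hoeffding_le_sum_sub_le [Nonempty κ] (hm : ∀ i, Measurable (Y i))
    (hind : iIndepFun Y μ) (hb : ∀ i, ∀ᵐ ω ∂μ, Y i ω ∈ Set.Icc (0 : ℝ) 1) (hx : 0 ≤ x) :
    μ.real {ω | √(Fintype.card κ * x / 2) ≤ ∑ i, (Y i ω - ∫ ω', Y i ω' ∂μ)} ≤ Real.exp (-x) := by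
  refine (HasSubgaussianMGF.measure_sum_ge_le_of_iIndepFun (s := Finset.univ)
    (hind.comp (fun i y => y - ∫ ω', Y i ω' ∂μ) fun i => measurable_id.sub_const _)
    (fun i _ => hasSubgaussianMGF_of_mem_Icc (hm i).aemeasurable (hb i))
    (Real.sqrt_nonneg _)).trans_eq ?_
  rw [Real.sq_sqrt (by positivity)]
  congr 1
  simp only [sub_zero, nnnorm_one, one_div, inv_pow, Finset.sum_const, Finset.card_univ,
    nsmul_eq_mul, NNReal.coe_mul, NNReal.coe_natCast, NNReal.coe_inv, NNReal.coe_pow,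
    NNReal.coe_ofNat]
  field_simp

theorem measureReal_hoeffding_le_abs_sum_sub_le [Nonempty κ] (hm : ∀ i, Measurable (Y i))
    (hind : iIndepFun Y μ) (hb : ∀ i, ∀ᵐ ω ∂μ, Y i ω ∈ Set.Icc (0 : ℝ) 1) (hx : 0 ≤ x) :
    μ.real {ω | √(Fintype.card κ * x / 2) ≤ |∑ i, (Y i ω - ∫ ω', Y i ω' ∂μ)|} ≤
      2 * Real.exp (-x) := by
  have hupper := measureReal_hoeffding_le_sum_sub_le hm hind hb hx
  have hlower := measureReal_hoeffding_le_sum_sub_le (Y := fun i ω => 1 - Y i ω)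
    (fun i => (hm i).const_sub 1) (hind.comp (fun _ y => 1 - y) fun _ => measurable_id.const_sub 1)
    (fun i => (hb i).mono fun _ h => ⟨sub_nonneg.2 h.2, by linarith [h.1]⟩) hx
  have hreflect (i : κ) (ω : Ω) : 1 - Y i ω - ∫ ω', (1 - Y i ω') ∂μ =
      -(Y i ω - ∫ ω', Y i ω' ∂μ) := by
    rw [integral_sub (integrable_const _) (.of_mem_Icc 0 1 (hm i).aemeasurable (hb i)),
      integral_const, probReal_univ, one_smul]
    ring
  simp only [hreflect, Finset.sum_neg_distrib] at hlower
  simp only [le_abs, Set.ofPred_or]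
  exact (measureReal_union_le _ _).trans (by linarith)

theorem measureReal_sum_le_sub_le (hm : ∀ i, Measurable (Y i)) (hind : iIndepFun Y μ)
    (hb : ∀ i, ∀ᵐ ω ∂μ, Y i ω ∈ Set.Icc (0 : ℝ) 1) (hx : 0 < x)
    (hv : 2 * x ≤ ∑ i, ∫ ω, Y i ω ∂μ) :
    μ.real {ω | ∑ i, Y i ω ≤
      ∑ i, ∫ ω, Y i ω ∂μ - √(2 * x) * √(∑ i, ∫ ω, Y i ω ∂μ) + x / 9} ≤ Real.exp (-x) := by
  set v := ∑ i, ∫ ω, Y i ω ∂μ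
  set q := √(2 * x)
  set s := √v
  have hq : q ^ 2 = 2 * x := Real.sq_sqrt (by positivity)
  have hs : s ^ 2 = v := Real.sq_sqrt (by linarith)
  have hs0 : 0 < s := Real.sqrt_pos.2 (by linarith)
  have hqs : q ≤ s := Real.sqrt_le_sqrt hv
  set l := q / s
  have hl : l ∈ Set.Icc (0 : ℝ) 1 := ⟨by positivity, (div_le_one hs0).2 hqs⟩
  have hchernoff := measureReal_sum_le_le_exp hm hind
    (fun i => integrable_exp_mul_of_mem_Icc (hm i).aemeasurable (hb i)) (neg_nonpos.2 hl.1)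
    (fun i => mgf_le_exp_of_mem_Icc (hm i).aemeasurable (hb i) _) (v - q * s + x / 9)
  refine hchernoff.trans (Real.exp_le_exp.2 ?_)
  rw [neg_neg, ← Finset.sum_mul]
  calc l * (v - q * s + x / 9) + v * (Real.exp (-l) - 1)
      ≤ l * (v - q * s + x / 9) + v * ((1 - l + l ^ 2 / 2 - l ^ 3 / 18) - 1) := by
        gcongr
        · linarith
        · exact exp_neg_le_one_sub_add_sq_sub_cube hl
    _ = l * (s ^ 2 - q * s + q ^ 2 / 18) + s ^ 2 * (-l + l ^ 2 / 2 - l ^ 3 / 18) := by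
        rw [hs, hq]
        ring
    _ = -(q ^ 2 / 2) := by
        simp only [l]
        field_simp
        ring
    _ = -x := by linarith

theorem measureReal_two_mul_add_le_sum_le (hm : ∀ i, Measurable (Y i)) (hind : iIndepFun Y μ)
    (hb : ∀ i, ∀ᵐ ω ∂μ, Y i ω ∈ Set.Icc (0 : ℝ) 1) (x : ℝ) :
    μ.real {ω | 2 * ∑ i, ∫ ω, Y i ω ∂μ + x ≤ ∑ i, Y i ω} ≤ Real.exp (-x) := by
  have hv : 0 ≤ ∑ i, ∫ ω, Y i ω ∂μ :=
    Finset.sum_nonneg fun i _ => integral_nonneg_of_ae ((hb i).mono fun _ h => h.1)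
  refine (measureReal_le_sum_le_exp hm hind
    (fun i => integrable_exp_mul_of_mem_Icc (hm i).aemeasurable (hb i)) zero_le_one
    (fun i => mgf_le_exp_of_mem_Icc (hm i).aemeasurable (hb i) 1) _).trans (Real.exp_le_exp.2 ?_)
  rw [← Finset.sum_mul]
  nlinarith [Real.exp_one_lt_three]

theorem measureReal_sum_sq_le_sub_le (hm : ∀ i, Measurable (Y i)) (hind : iIndepFun Y μ)
    (hb : ∀ i, ∀ᵐ ω ∂μ, |Y i ω| ≤ 1) (hx : 0 < x) :
    μ.real {ω | √(2 * x) ≤ √(∑ i, ∫ ω', Y i ω' ^ 2 ∂μ) ∧ ∑ i, Y i ω ^ 2 ≤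
      ∑ i, ∫ ω', Y i ω' ^ 2 ∂μ - √(2 * x) * √(∑ i, ∫ ω', Y i ω' ^ 2 ∂μ) + x / 9} ≤
      Real.exp (-x) := by
  by_cases hv : √(2 * x) ≤ √(∑ i, ∫ ω', Y i ω' ^ 2 ∂μ)
  · have hsq (i : κ) : ∀ᵐ ω ∂μ, Y i ω ^ 2 ∈ Set.Icc (0 : ℝ) 1 :=
      (hb i).mono fun ω hω => ⟨sq_nonneg _, sq_le_one_iff_abs_le_one _ |>.2 hω⟩
    simp only [hv, true_and]
    exact measureReal_sum_le_sub_le (fun i => (hm i).pow_const 2)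
      (hind.comp (fun _ y => y ^ 2) fun _ => measurable_id.pow_const 2) hsq hx
      ((Real.sqrt_le_sqrt_iff (Finset.sum_nonneg fun i _ => integral_nonneg fun ω => sq_nonneg _)).1
        hv)
  · simp only [hv, false_and, Set.ofPred_false, measureReal_empty]
    positivity

/-- The sum of squared deviations `∑ᵢ (yᵢ - ȳ)²` of a finite sample from its mean `ȳ`, that is, the
sample variance before normalization. -/
noncomputable def sumSqDev (y : κ → ℝ) : ℝ := ∑ i, (y i - (∑ j, y j) / Fintype.card κ) ^ 2

lemma sumSqDev_nonneg (y : κ → ℝ) : 0 ≤ sumSqDev y := Finset.sum_nonneg fun _ _ => sq_nonneg _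

lemma sum_sub_sq_eq_sumSqDev_add [Nonempty κ] (y : κ → ℝ) (a : ℝ) :
    ∑ i, (y i - a) ^ 2 = sumSqDev y + (∑ i, (y i - a)) ^ 2 / Fintype.card κ := by
  have hn : (Fintype.card κ : ℝ) ≠ 0 := Nat.cast_ne_zero.2 Fintype.card_ne_zero
  simp only [sumSqDev, sub_sq, Finset.sum_add_distrib, Finset.sum_sub_distrib, ← Finset.sum_mul,
    ← Finset.mul_sum, Finset.sum_const, Finset.card_univ, nsmul_eq_mul]
  field_simp
  ring

lemma sumSqDev_le_sum_sq [Nonempty κ] (y : κ → ℝ) : sumSqDev y ≤ ∑ i, y i ^ 2 := by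
  have h := sum_sub_sq_eq_sumSqDev_add y 0
  simp only [sub_zero] at h
  rw [h]
  exact le_add_of_nonneg_right (by positivity)

lemma sumSqDev_sub_div [Nonempty κ] (y : κ → ℝ) (a L : ℝ) :
    sumSqDev (fun i => (y i - a) / L) = sumSqDev y / L ^ 2 := by
  have hn : (Fintype.card κ : ℝ) ≠ 0 := Nat.cast_ne_zero.2 Fintype.card_ne_zero
  have hmean : (∑ j, (y j - a) / L) / Fintype.card κ = ((∑ j, y j) / Fintype.card κ - a) / L := by
    rw [← Finset.sum_div, Finset.sum_sub_distrib, Finset.sum_const, Finset.card_univ, nsmul_eq_mul]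
    field_simp
  simp only [sumSqDev, hmean]
  simp only [← sub_div, sub_sub_sub_cancel_right, div_pow, ← Finset.sum_div]

lemma le_mul_add_of_self_bounding {q s w T : ℝ} (hq : 0 ≤ q) (hw : 0 ≤ w)
    (hlow : q ≤ s → s ^ 2 - q * s + q ^ 2 / 18 ≤ w ^ 2 + q ^ 2 / 4)
    (hT : T ≤ q * s + q ^ 2 / 6) : T ≤ q * w + 4 * q ^ 2 / 3 := by
  have hs : s ≤ w + 7 * q / 6 := by
    by_cases hqs : q ≤ s
    · have hsq : (s - q / 2) ^ 2 ≤ (w + 2 * q / 3) ^ 2 := by nlinarith [hlow hqs, mul_nonneg hq hw]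
      have := abs_le_of_sq_le_sq' hsq (by positivity)
      linarith
    · linarith
  calc T ≤ q * s + q ^ 2 / 6 := hT
    _ ≤ q * (w + 7 * q / 6) + q ^ 2 / 6 := by gcongr
    _ = q * w + 4 * q ^ 2 / 3 := by ring

lemma abs_le_sqrt_mul_sqrt_add_of_self_bounding {v S T n : ℝ} (hx : 0 ≤ x) (hn : 0 < n)
    (hS : 0 ≤ S) (hv : 0 ≤ v) (hbernstein : |T| < √(2 * x) * √v + x / 3)
    (hhoeffding : |T| < √(n * x / 2))
    (hlower : √(2 * x) ≤ √v → v - √(2 * x) * √v + x / 9 < S + T ^ 2 / n) :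
    |T| ≤ √(2 * x) * √S + 8 * x / 3 := by
  have hq : √(2 * x) ^ 2 = 2 * x := Real.sq_sqrt (by positivity)
  have hTn : T ^ 2 / n ≤ x / 2 := by
    rw [div_le_iff₀ hn, ← sq_abs, ← Real.sq_sqrt (by positivity : 0 ≤ x / 2 * n)]
    gcongr
    exact hhoeffding.le.trans_eq (by congr 1; ring)
  have hself := le_mul_add_of_self_bounding (Real.sqrt_nonneg (2 * x)) (Real.sqrt_nonneg S)
    (s := √v) (T := |T|) (fun hqs => by
      rw [hq, Real.sq_sqrt hv, Real.sq_sqrt hS]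
      linarith [hlower hqs])
    (by rw [hq]; linarith)
  rw [hq] at hself
  linarith

lemma sum_integral_div_card_mem_Icc [Nonempty κ] (hm : ∀ i, Measurable (Y i))
    (hb : ∀ i, ∀ᵐ ω ∂μ, Y i ω ∈ Set.Icc (0 : ℝ) 1) :
    (∑ i, ∫ ω, Y i ω ∂μ) / Fintype.card κ ∈ Set.Icc (0 : ℝ) 1 := by
  have hmean (i : κ) : ∫ ω, Y i ω ∂μ ∈ Set.Icc (0 : ℝ) 1 :=
    (convex_Icc 0 1).integral_mem isClosed_Icc (hb i) (.of_mem_Icc 0 1 (hm i).aemeasurable (hb i))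
  refine ⟨div_nonneg (Finset.sum_nonneg fun i _ => (hmean i).1) (Nat.cast_nonneg _),
    div_le_one_of_le₀ ?_ (Nat.cast_nonneg _)⟩
  simpa using Finset.sum_le_sum fun i (_ : i ∈ Finset.univ) => (hmean i).2

theorem measureReal_empirical_bernstein_unit_le [Nonempty κ] (hm : ∀ i, Measurable (Y i))
    (hind : iIndepFun Y μ) (hb : ∀ i, ∀ᵐ ω ∂μ, Y i ω ∈ Set.Icc (0 : ℝ) 1) (hx : 0 < x) :
    μ.real {ω | √(2 * x) * √(sumSqDev fun i => Y i ω) + 8 * x / 3 <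
      |∑ i, (Y i ω - ∫ ω', Y i ω' ∂μ)|} ≤ 5 * Real.exp (-x) := by
  have hn : (0 : ℝ) < Fintype.card κ := Nat.cast_pos.2 Fintype.card_pos
  have hint (i : κ) : Integrable (Y i) μ := .of_mem_Icc 0 1 (hm i).aemeasurable (hb i)
  set m := (∑ i, ∫ ω', Y i ω' ∂μ) / Fintype.card κ
  have hcard : Fintype.card κ * m = ∑ i, ∫ ω', Y i ω' ∂μ := mul_div_cancel₀ _ hn.ne'
  have hsum (ω : Ω) : ∑ i, (Y i ω - m) = ∑ i, (Y i ω - ∫ ω', Y i ω' ∂μ) := by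
    simp only [Finset.sum_sub_distrib, Finset.sum_const, Finset.card_univ, nsmul_eq_mul, hcard]
  have hm01 : m ∈ Set.Icc (0 : ℝ) 1 := sum_integral_div_card_mem_Icc hm hb
  have hbdev (i : κ) : ∀ᵐ ω ∂μ, |Y i ω - m| ≤ 1 := (hb i).mono fun ω hω =>
    abs_sub_le_iff.2 ⟨by linarith [hω.2, hm01.1], by linarith [hω.1, hm01.2]⟩
  have hmdev (i : κ) : Measurable fun ω => Y i ω - m := (hm i).sub_const m
  have hinddev : iIndepFun (fun i ω => Y i ω - m) μ :=
    hind.comp (fun _ y => y - m) fun _ => measurable_id.sub_const m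
  have hcentered : ∑ i, ∫ ω, (Y i ω - m) ∂μ = 0 := by
    simp only [integral_sub (hint _) (integrable_const m), integral_const, probReal_univ, one_smul,
      Finset.sum_sub_distrib, Finset.sum_const, Finset.card_univ, nsmul_eq_mul, hcard, sub_self]
  have hbernstein := measureReal_bernstein_le_abs_sum_le hmdev hinddev hbdev hcentered hx
  have hhoeffding := measureReal_hoeffding_le_abs_sum_sub_le hm hind hb hx.le
  have hlower := measureReal_sum_sq_le_sub_le hmdev hinddev hbdev hx
  have hv : 0 ≤ ∑ i, ∫ ω, (Y i ω - m) ^ 2 ∂μ :=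
    Finset.sum_nonneg fun i _ => integral_nonneg fun ω => sq_nonneg _
  simp only [sum_sub_sq_eq_sumSqDev_add, hsum] at hbernstein hlower
  refine (measureReal_mono ?_).trans ((measureReal_union_le _ _).trans (add_le_add
    ((measureReal_union_le _ _).trans (add_le_add hbernstein hhoeffding)) hlower)) |>.trans_eq
    (by ring)
  intro ω hω
  by_contra hgood
  simp only [Set.mem_union, Set.mem_ofPred_eq, not_or, not_le, not_and] at hω hgood
  exact hω.not_ge (abs_le_sqrt_mul_sqrt_add_of_self_bounding hx.le hn (sumSqDev_nonneg _) hv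
    hgood.1.1 hgood.1.2 hgood.2)

theorem measureReal_empirical_bernstein_le [Nonempty κ] {a b : ℝ} (hab : a < b)
    (hm : ∀ i, Measurable (Y i)) (hind : iIndepFun Y μ)
    (hb : ∀ i, ∀ᵐ ω ∂μ, Y i ω ∈ Set.Icc a b) (hx : 0 < x) :
    μ.real {ω | √(2 * x) * √(sumSqDev fun i => Y i ω) + 8 * (b - a) * x / 3 <
      |∑ i, (Y i ω - ∫ ω', Y i ω' ∂μ)|} ≤ 5 * Real.exp (-x) := by
  have hL : 0 < b - a := sub_pos.2 hab
  have hunit := measureReal_empirical_bernstein_unit_le (Y := fun i ω => (Y i ω - a) / (b - a))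
    (fun i => ((hm i).sub_const a).div_const _)
    (hind.comp (fun _ y => (y - a) / (b - a)) fun _ => (measurable_id.sub_const a).div_const _)
    (fun i => (hb i).mono fun ω hω => ⟨div_nonneg (sub_nonneg.2 hω.1) hL.le,
      (div_le_one hL).2 (sub_le_sub_right hω.2 a)⟩) hx
  have hscale (i : κ) (ω : Ω) : (Y i ω - a) / (b - a) - ∫ ω', (Y i ω' - a) / (b - a) ∂μ =
      (Y i ω - ∫ ω', Y i ω' ∂μ) / (b - a) := by
    rw [integral_div, integral_sub (.of_mem_Icc a b (hm i).aemeasurable (hb i))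
      (integrable_const a), integral_const, probReal_univ, one_smul, ← sub_div,
      sub_sub_sub_cancel_right]
  simp only [hscale, sumSqDev_sub_div, ← Finset.sum_div, abs_div, abs_of_pos hL,
    Real.sqrt_div (sumSqDev_nonneg _), Real.sqrt_sq hL.le, lt_div_iff₀ hL] at hunit
  refine le_of_eq_of_le ?_ hunit
  congr! 4
  field_simp

theorem measureReal_sumSqDev_ge_le [Nonempty κ] {b W : ℝ} (hb0 : 0 < b)
    (hm : ∀ i, Measurable (Y i)) (hind : iIndepFun Y μ) (hb : ∀ i, ∀ᵐ ω ∂μ, |Y i ω| ≤ b)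
    (hW : ∀ i, ∫ ω, Y i ω ^ 2 ∂μ ≤ W) (x : ℝ) :
    μ.real {ω | 2 * (Fintype.card κ * W) + b ^ 2 * x ≤ sumSqDev fun i => Y i ω} ≤
      Real.exp (-x) := by
  have hunit := measureReal_two_mul_add_le_sum_le (Y := fun i ω => (Y i ω / b) ^ 2)
    (fun i => ((hm i).div_const b).pow_const 2)
    (hind.comp (fun _ y => (y / b) ^ 2) fun _ => (measurable_id.div_const b).pow_const 2)
    (fun i => (hb i).mono fun ω hω => ⟨sq_nonneg _, (sq_le_one_iff_abs_le_one _).2 (by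
      rwa [abs_div, abs_of_pos hb0, div_le_one hb0])⟩) x
  simp only [div_pow, integral_div, ← Finset.sum_div] at hunit
  refine (measureReal_mono fun ω hω => ?_).trans hunit
  rw [Set.mem_ofPred_eq] at hω ⊢
  have hsum : ∑ i, ∫ ω, Y i ω ^ 2 ∂μ ≤ Fintype.card κ * W := by
    simpa using Finset.sum_le_sum fun i (_ : i ∈ Finset.univ) => hW i
  have := hω.trans (sumSqDev_le_sum_sq _)
  field_simp
  linarith

lemma one_sub_sum_le_measureReal_forall {ι : Type*} {s : Finset ι} {p : ι → Ω → Prop} {ε : ι → ℝ}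
    (h : ∀ k ∈ s, μ.real {ω | ¬p k ω} ≤ ε k) :
    1 - ∑ k ∈ s, ε k ≤ μ.real {ω | ∀ k ∈ s, p k ω} := by
  have hcover : (Set.univ : Set Ω) ⊆ {ω | ∀ k ∈ s, p k ω} ∪ ⋃ k ∈ s, {ω | ¬p k ω} := fun ω _ => by
    by_cases hω : ∀ k ∈ s, p k ω
    · exact Or.inl hω
    · push Not at hω
      exact Or.inr (by simpa using hω)
  have hbad : μ.real (⋃ k ∈ s, {ω | ¬p k ω}) ≤ ∑ k ∈ s, ε k :=
    (measureReal_biUnion_finset_le _ _).trans (Finset.sum_le_sum h)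
  have := (measureReal_mono (μ := μ) hcover).trans (measureReal_union_le _ _)
  rw [probReal_univ] at this
  linarith

lemma ae_abs_sum_sub_integral_le {M : ℝ} (hb : ∀ i, ∀ᵐ ω ∂μ, |Y i ω| ≤ M / 2) :
    ∀ᵐ ω ∂μ, |∑ i, (Y i ω - ∫ ω', Y i ω' ∂μ)| ≤ Fintype.card κ * M := by
  filter_upwards [ae_all_iff.2 hb] with ω hω
  have hmean (i : κ) : |∫ ω', Y i ω' ∂μ| ≤ M / 2 := by
    simpa using norm_integral_le_of_norm_le_const (f := Y i) (hb i)
  calc |∑ i, (Y i ω - ∫ ω', Y i ω' ∂μ)| ≤ ∑ _i : κ, M :=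
        (Finset.abs_sum_le_sum_abs _ _).trans (Finset.sum_le_sum fun i _ =>
          (abs_sub _ _).trans (by linarith [hω i, hmean i]))
    _ = Fintype.card κ * M := by simp

end Concentration

section Window

/-- The samples in the window of length `k`: the pairs `(j, i)` of a period `j` of the window and an
index `i` into the batch of that period. It turns the double sums over the window into sums over a
single finite type. -/
def windowIndex (B : ℕ → ℕ) (t k : ℕ) : Finset (Σ _ : ℕ, ℕ) :=
  (Finset.Icc (t - k + 1) t).sigma fun j => Finset.Icc 1 (B j)

variable {B : ℕ → ℕ} {t k : ℕ}

lemma mem_windowIndex {p : Σ _ : ℕ, ℕ} :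
    p ∈ windowIndex B t k ↔ p.1 ∈ Finset.Icc (t - k + 1) t ∧ p.2 ∈ Finset.Icc 1 (B p.1) :=
  Finset.mem_sigma

lemma card_windowIndex : Fintype.card (windowIndex B t k) = windowSize B t k := by
  rw [Fintype.card_coe, windowIndex, Finset.card_sigma]
  simp only [Nat.card_Icc, windowSize, Nat.add_sub_cancel]

lemma sum_windowIndex (g : ℕ → ℕ → ℝ) :
    ∑ p : windowIndex B t k, g p.1.1 p.1.2 =
      ∑ j ∈ Finset.Icc (t - k + 1) t, ∑ i ∈ Finset.Icc 1 (B j), g j i := by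
  rw [Finset.sum_coe_sort (windowIndex B t k) fun p => g p.1 p.2, windowIndex, Finset.sum_sigma]

lemma windowMean_eq_sum_windowIndex (u : ℕ → ℕ → ℝ) :
    windowMean B u t k = (∑ p : windowIndex B t k, u p.1.1 p.1.2) / windowSize B t k := by
  rw [windowMean, sum_windowIndex]

lemma windowMean_congr {u v : ℕ → ℕ → ℝ} (h : ∀ p ∈ windowIndex B t k, u p.1 p.2 = v p.1 p.2) :
    windowMean B u t k = windowMean B v t k := by
  rw [windowMean_eq_sum_windowIndex, windowMean_eq_sum_windowIndex]
  exact congrArg (· / _) (Finset.sum_congr rfl fun p _ => h p p.2)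

lemma windowMean_sub_windowMean (u v : ℕ → ℕ → ℝ) :
    windowMean B u t k - windowMean B v t k =
      (∑ p : windowIndex B t k, (u p.1.1 p.1.2 - v p.1.1 p.1.2)) / windowSize B t k := by
  rw [windowMean_eq_sum_windowIndex, windowMean_eq_sum_windowIndex, Finset.sum_sub_distrib, sub_div]

lemma windowVar_eq_sumSqDev_div (u : ℕ → ℕ → ℝ) :
    windowVar B u t k =
      sumSqDev (fun p : windowIndex B t k => u p.1.1 p.1.2) / ((windowSize B t k : ℝ) - 1) := by
  rw [windowVar, sumSqDev, card_windowIndex, ← windowMean_eq_sum_windowIndex,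
    sum_windowIndex fun j i => (u j i - windowMean B u t k) ^ 2]

lemma windowSize_pos (hB : ∀ j, 1 ≤ j → 1 ≤ B j) (hk : k ∈ Set.Icc 1 t) :
    0 < windowSize B t k :=
  Finset.sum_pos (fun j hj => hB j (by rw [Finset.mem_Icc] at hj; omega))
    ⟨t, Finset.mem_Icc.2 ⟨by have := hk.1; have := hk.2; omega, le_rfl⟩⟩

lemma abs_windowMean_sub_le {e : ℕ → ℕ → ℝ} {θ b : ℝ} (hn : 0 < windowSize B t k)
    (he : ∀ p ∈ windowIndex B t k, |e p.1 p.2 - θ| ≤ b) : |windowMean B e t k - θ| ≤ b := by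
  have hn' : (0 : ℝ) < windowSize B t k := Nat.cast_pos.2 hn
  have hmean : windowMean B e t k - θ =
      (∑ p : windowIndex B t k, (e p.1.1 p.1.2 - θ)) / windowSize B t k := by
    rw [windowMean_eq_sum_windowIndex, Finset.sum_sub_distrib, Finset.sum_const, Finset.card_univ,
      card_windowIndex, nsmul_eq_mul, sub_div, mul_div_cancel_left₀ _ hn'.ne']
  rw [hmean, abs_div, abs_of_pos hn', div_le_iff₀ hn']
  calc |∑ p : windowIndex B t k, (e p.1.1 p.1.2 - θ)| ≤ ∑ _p : windowIndex B t k, b :=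
        (Finset.abs_sum_le_sum_abs _ _).trans (Finset.sum_le_sum fun p _ => he p p.2)
    _ = b * windowSize B t k := by
        rw [Finset.sum_const, Finset.card_univ, card_windowIndex, nsmul_eq_mul, mul_comm]

lemma div_windowSize_le_psiHat {u : ℕ → ℕ → ℝ} {M δ : ℝ} (hn : 2 ≤ windowSize B t k) (hM : 0 ≤ M)
    (hx : 0 ≤ Real.log (2 / δ)) :
    (√(2 * Real.log (2 / δ)) * √(sumSqDev fun p : windowIndex B t k => u p.1.1 p.1.2) +
      8 * M * Real.log (2 / δ) / 3) / windowSize B t k ≤ psiHat B u M δ t k := by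
  have hn' : (2 : ℝ) ≤ windowSize B t k := Nat.ofNat_le_cast.2 hn
  rw [psiHat, if_neg (by omega), windowVar_eq_sumSqDev_div]
  set n : ℝ := (windowSize B t k : ℝ)
  set x := Real.log (2 / δ)
  set S := sumSqDev fun p : windowIndex B t k => u p.1.1 p.1.2
  have hn1 : 0 < n - 1 := by linarith
  have hS : 0 ≤ S := sumSqDev_nonneg _
  calc (√(2 * x) * √S + 8 * M * x / 3) / n = √(S / n) * √(2 * x / n) + 8 * M * x / (3 * n) := by
        rw [Real.sqrt_div hS, Real.sqrt_div (by positivity), div_mul_div_comm,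
          Real.mul_self_sqrt (by positivity), add_div, div_div, mul_comm √S]
    _ ≤ √(S / (n - 1)) * √(2 * x / n) + 8 * M * x / (3 * (n - 1)) := by
        gcongr <;> linarith

lemma inv_sub_one_le_two_div {n : ℝ} (hn : 2 ≤ n) : (n - 1)⁻¹ ≤ 2 / n := by
  rw [inv_le_iff_one_le_mul₀ (by linarith)]
  field_simp
  linarith

lemma sqrt_div_sub_one_le {n x S W M : ℝ} (hn : 2 ≤ n) (hx : 0 ≤ x) (hM : 0 ≤ M) (hW : 0 ≤ W)
    (hS : S ≤ 2 * (n * W) + (M / 2) ^ 2 * x) :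
    √(S / (n - 1)) ≤ 2 * √W + M * √(x / n / 2) := by
  refine Real.sqrt_le_iff.2 ⟨by positivity, ?_⟩
  calc S / (n - 1) ≤ (2 * (n * W) + (M / 2) ^ 2 * x) * (2 / n) := by
        rw [div_eq_mul_inv]
        gcongr
        · exact inv_nonneg.2 (by linarith)
        · exact inv_sub_one_le_two_div hn
    _ = 4 * √W ^ 2 + M ^ 2 * √(x / n / 2) ^ 2 := by
        rw [Real.sq_sqrt hW, Real.sq_sqrt (by positivity)]
        field_simp
        ring
    _ ≤ (2 * √W + M * √(x / n / 2)) ^ 2 := by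
        have : 0 ≤ 2 * √W * (M * √(x / n / 2)) := by positivity
        linarith

lemma psiHat_le {u : ℕ → ℕ → ℝ} {M W δ : ℝ} (hn : 0 < windowSize B t k) (hM : 0 ≤ M) (hW : 0 ≤ W)
    (hx : 1 ≤ Real.log (2 / δ))
    (hS : sumSqDev (fun p : windowIndex B t k => u p.1.1 p.1.2) ≤
      2 * (windowSize B t k * W) + (M / 2) ^ 2 * Real.log (2 / δ)) :
    psiHat B u M δ t k ≤ 3 * √(Real.log (2 / δ) / windowSize B t k) * √W +
      7 * M * (Real.log (2 / δ) / windowSize B t k) := by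
  rw [psiHat]
  split_ifs with h1
  · rw [h1, Nat.cast_one, div_one]
    have : 0 ≤ 3 * √(Real.log (2 / δ)) * √W := by positivity
    nlinarith
  rw [windowVar_eq_sumSqDev_div]
  have hn' : (2 : ℝ) ≤ windowSize B t k := Nat.ofNat_le_cast.2 (by omega)
  set n : ℝ := (windowSize B t k : ℝ)
  set x := Real.log (2 / δ)
  set a := x / n with ha_def
  have ha : 0 ≤ a := by positivity
  have hsqrt : √(2 * x / n) ≤ 3 / 2 * √a := by
    rw [mul_div_assoc]
    refine Real.sqrt_le_iff.2 ⟨by positivity, ?_⟩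
    rw [mul_pow, Real.sq_sqrt ha]
    linarith
  have hcross : √(a / 2) * √(2 * x / n) = a := by
    rw [← Real.sqrt_mul (by positivity), Real.sqrt_eq_iff_mul_self_eq (by positivity) ha, ha_def]
    ring
  calc √(sumSqDev (fun p : windowIndex B t k => u p.1.1 p.1.2) / (n - 1)) * √(2 * x / n) +
        8 * M * x / (3 * (n - 1))
      ≤ (2 * √W + M * √(a / 2)) * √(2 * x / n) + 8 * M * x / 3 * (2 / n) := by
        rw [← div_div, div_eq_mul_inv (8 * M * x / 3)]
        gcongr
        · exact sqrt_div_sub_one_le hn' (by linarith) hM hW hS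
        · exact inv_sub_one_le_two_div hn'
    _ = 2 * √W * √(2 * x / n) + M * a + 16 / 3 * M * a := by
        rw [add_mul, mul_assoc M, hcross, ha_def]
        ring
    _ ≤ 2 * √W * (3 / 2 * √a) + M * a + 16 / 3 * M * a := by gcongr
    _ ≤ 3 * √a * √W + 7 * M * a := by linarith [mul_nonneg hM ha]

section WindowConcentration

variable {Ω : Type*} [MeasurableSpace Ω] {μ : Measure Ω} [IsProbabilityMeasure μ]
  {u : ℕ → ℕ → Ω → ℝ} {M W δ : ℝ}

lemma measureReal_psiHat_lt_abs_windowMean_sub_le (hn : 0 < windowSize B t k) (hM : 0 < M)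
    (hx : 0 < Real.log (2 / δ)) (hm : ∀ p ∈ windowIndex B t k, Measurable (u p.1 p.2))
    (hind : iIndepFun (fun p : windowIndex B t k => u p.1.1 p.1.2) μ)
    (hb : ∀ p ∈ windowIndex B t k, ∀ᵐ ω ∂μ, |u p.1 p.2 ω| ≤ M / 2) :
    μ.real {ω | psiHat B (fun j i => u j i ω) M δ t k <
      |windowMean B (fun j i => u j i ω) t k - windowMean B (fun j i => ∫ ω', u j i ω' ∂μ) t k|} ≤
      5 * Real.exp (-Real.log (2 / δ)) := by
  have hn' : (0 : ℝ) < windowSize B t k := Nat.cast_pos.2 hn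
  have : Nonempty (windowIndex B t k) := Fintype.card_pos_iff.1 (by rwa [card_windowIndex])
  have hbκ (p : windowIndex B t k) : ∀ᵐ ω ∂μ, |u p.1.1 p.1.2 ω| ≤ M / 2 := hb p p.2
  simp only [windowMean_sub_windowMean, abs_div, abs_of_pos hn']
  by_cases h1 : windowSize B t k = 1
  · have hnull : ∀ᵐ ω ∂μ, ¬psiHat B (fun j i => u j i ω) M δ t k <
        |∑ p : windowIndex B t k, (u p.1.1 p.1.2 ω - ∫ ω', u p.1.1 p.1.2 ω' ∂μ)| /
          windowSize B t k := by
      filter_upwards [ae_abs_sum_sub_integral_le hbκ] with ω hω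
      rw [card_windowIndex, h1, Nat.cast_one, one_mul] at hω
      rwa [psiHat, if_pos h1, h1, Nat.cast_one, div_one, not_lt]
    exact ((measureReal_eq_zero_iff (measure_ne_top _ _)).2
      (measure_eq_zero_iff_ae_notMem.2 hnull)).le.trans (by positivity)
  · refine (measureReal_mono fun ω hω => ?_).trans (measureReal_empirical_bernstein_le
      (Y := fun p : windowIndex B t k => u p.1.1 p.1.2) (neg_lt_self (half_pos hM))
      (fun p => hm p p.2) hind (fun p => (hbκ p).mono fun ω => abs_le.1) hx)
    have hlow := (div_windowSize_le_psiHat (u := fun j i => u j i ω) (by omega) hM.le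
      hx.le).trans_lt hω
    rw [div_lt_div_iff_of_pos_right hn'] at hlow
    rwa [Set.mem_ofPred_eq, sub_neg_eq_add, add_halves]

lemma measureReal_lt_psiHat_le (hn : 0 < windowSize B t k) (hM : 0 < M) (hW : 0 ≤ W)
    (hx : 1 ≤ Real.log (2 / δ)) (hm : ∀ p ∈ windowIndex B t k, Measurable (u p.1 p.2))
    (hind : iIndepFun (fun p : windowIndex B t k => u p.1.1 p.1.2) μ)
    (hb : ∀ p ∈ windowIndex B t k, ∀ᵐ ω ∂μ, |u p.1 p.2 ω| ≤ M / 2)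
    (hu : ∀ p ∈ windowIndex B t k, ∫ ω, u p.1 p.2 ω ^ 2 ∂μ ≤ W) :
    μ.real {ω | 3 * √(Real.log (2 / δ) / windowSize B t k) * √W +
      7 * M * (Real.log (2 / δ) / windowSize B t k) < psiHat B (fun j i => u j i ω) M δ t k} ≤
      Real.exp (-Real.log (2 / δ)) := by
  have : Nonempty (windowIndex B t k) := Fintype.card_pos_iff.1 (by rwa [card_windowIndex])
  refine (measureReal_mono fun ω hω => ?_).trans (measureReal_sumSqDev_ge_le
    (Y := fun p : windowIndex B t k => u p.1.1 p.1.2) (half_pos hM) (fun p => hm p p.2) hind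
    (fun p => hb p p.2) (fun p => hu p p.2) (Real.log (2 / δ)))
  by_contra hS
  rw [Set.mem_ofPred_eq, not_le, card_windowIndex] at hS
  exact hω.not_ge (psiHat_le hn hM.le hW hx hS.le)

lemma windowIndex_subset : windowIndex B t k ⊆ windowIndex B t t := fun p hp => by
  simp only [mem_windowIndex, Finset.mem_Icc] at hp ⊢
  omega

lemma one_le_log_six_mul_div (ht : 1 ≤ t) (hδ : δ ∈ Set.Ioo (0 : ℝ) 1) :
    1 ≤ Real.log (6 * t / δ) := by
  have ht' : (1 : ℝ) ≤ t := Nat.one_le_cast.2 ht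
  have hδ0 : 0 < δ := hδ.1
  rw [Real.le_log_iff_exp_le (by positivity), le_div_iff₀ hδ0]
  nlinarith [Real.exp_one_lt_three, Real.exp_pos 1, hδ.2]

/-- The good event of the analysis at confidence level `δ`, for data `u` with means `e`: in every
window the error of `windowMean` is at most `psiHat` at level `δ / (3 * t)`, and `psiHat` is at most
its deterministic counterpart, with `W` in place of the empirical variance. -/
def WindowsAccurate (B : ℕ → ℕ) (u e : ℕ → ℕ → ℝ) (M W δ : ℝ) (t : ℕ) : Prop :=
  ∀ k ∈ Finset.Icc 1 t,
    |windowMean B u t k - windowMean B e t k| ≤ psiHat B u M (δ / (3 * t)) t k ∧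
    psiHat B u M (δ / (3 * t)) t k ≤
      3 * √(Real.log (6 * t / δ) / windowSize B t k) * √W +
        7 * M * (Real.log (6 * t / δ) / windowSize B t k)

theorem one_sub_le_measureReal_windowsAccurate (ht : 1 ≤ t) (hB : ∀ j, 1 ≤ j → 1 ≤ B j)
    (hM : 0 < M) (hW : 0 ≤ W) (hδ : δ ∈ Set.Ioo (0 : ℝ) 1)
    (hm : ∀ p ∈ windowIndex B t t, Measurable (u p.1 p.2))
    (hind : iIndepFun (fun p : windowIndex B t t => u p.1.1 p.1.2) μ)
    (hb : ∀ p ∈ windowIndex B t t, ∀ᵐ ω ∂μ, |u p.1 p.2 ω| ≤ M / 2)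
    (hu : ∀ p ∈ windowIndex B t t, ∫ ω, u p.1 p.2 ω ^ 2 ∂μ ≤ W) :
    1 - δ ≤ μ.real {ω |
      WindowsAccurate B (fun j i => u j i ω) (fun j i => ∫ ω', u j i ω' ∂μ) M W δ t} := by
  have hδ0 : 0 < δ := hδ.1
  have hlevel : 2 / (δ / (3 * t)) = 6 * t / δ := by
    field_simp
    ring
  have hx := one_le_log_six_mul_div ht hδ
  have hexp : Real.exp (-Real.log (6 * t / δ)) = δ / (6 * t) := by
    rw [Real.exp_neg, Real.exp_log (by positivity), inv_div]
  have hsum : ∑ k ∈ Finset.Icc 1 t, (5 * (δ / (6 * t)) + δ / (6 * t)) ≤ δ := by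
    rw [Finset.sum_const, Nat.card_Icc, Nat.add_sub_cancel, nsmul_eq_mul]
    exact le_of_eq (by field_simp; norm_num)
  unfold WindowsAccurate
  refine (sub_le_sub_left hsum 1).trans (one_sub_sum_le_measureReal_forall fun k hk => ?_)
  have hn := windowSize_pos hB (Finset.mem_Icc.1 hk)
  have hsub (p) (hp : p ∈ windowIndex B t k) : p ∈ windowIndex B t t := windowIndex_subset hp
  have hindk : iIndepFun (fun p : windowIndex B t k => u p.1.1 p.1.2) μ :=
    hind.precomp (g := Set.inclusion windowIndex_subset) (Set.inclusion_injective _)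
  have hdev := measureReal_psiHat_lt_abs_windowMean_sub_le (δ := δ / (3 * t)) hn hM
    (by rw [hlevel]; linarith) (fun p hp => hm p (hsub p hp)) hindk fun p hp => hb p (hsub p hp)
  have hpsi := measureReal_lt_psiHat_le (δ := δ / (3 * t)) hn hM hW (by rwa [hlevel])
    (fun p hp => hm p (hsub p hp)) hindk (fun p hp => hb p (hsub p hp))
    fun p hp => hu p (hsub p hp)
  rw [hlevel, hexp] at hdev hpsi
  refine le_trans ?_ ((measureReal_union_le _ _).trans (add_le_add hdev hpsi))
  refine measureReal_mono fun ω hω => ?_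
  rw [Set.mem_ofPred_eq, not_and_or, not_le, not_le] at hω
  exact hω

end WindowConcentration

section AdaptiveWindow

variable {u : ℕ → ℕ → ℝ} {M δ : ℝ} {khat : ℕ}

lemma phiHat_nonneg : 0 ≤ phiHat B u M δ t k :=
  Real.iSup_nonneg fun _ => le_max_right _ _

lemma abs_windowMean_sub_windowMean_le_phiHat_add {i : ℕ} (hi : i ∈ Set.Icc 1 k) :
    |windowMean B u t k - windowMean B u t i| ≤
      phiHat B u M δ t k + (psiHat B u M δ t k + psiHat B u M δ t i) := by
  rw [← sub_le_iff_le_add]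
  exact (le_max_left _ _).trans (le_ciSup (f := fun i : Set.Icc 1 k =>
    max (|windowMean B u t k - windowMean B u t i| - (psiHat B u M δ t k + psiHat B u M δ t i)) 0)
    (Set.finite_range _).bddAbove ⟨i, hi⟩)

lemma phiHat_le {θ b : ℝ} (hk : 1 ≤ k)
    (h : ∀ i ∈ Set.Icc 1 k, |windowMean B u t i - θ| ≤ b + psiHat B u M δ t i) (hb : 0 ≤ b) :
    phiHat B u M δ t k ≤ 2 * b := by
  have : Nonempty (Set.Icc 1 k) := ⟨⟨k, hk, le_rfl⟩⟩
  refine ciSup_le fun i => max_le ?_ (by positivity)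
  rw [sub_le_iff_le_add]
  calc |windowMean B u t k - windowMean B u t i|
      ≤ |windowMean B u t k - θ| + |θ - windowMean B u t i| := abs_sub_le _ _ _
    _ ≤ (b + psiHat B u M δ t k) + (b + psiHat B u M δ t i) := by
        rw [abs_sub_comm θ]
        exact add_le_add (h k ⟨hk, le_rfl⟩) (h i i.2)
    _ = 2 * b + (psiHat B u M δ t k + psiHat B u M δ t i) := by ring

theorem IsAdaptiveWindow.abs_windowMean_sub_le (hkhat : IsAdaptiveWindow B u M δ t khat)
    (hk : k ∈ Set.Icc 1 t) {θ b : ℝ} (hb : 0 ≤ b)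
    (h : ∀ i ∈ Set.Icc 1 k, |windowMean B u t i - θ| ≤ b + psiHat B u M δ t i) :
    |windowMean B u t khat - θ| ≤ 5 * b + 3 * psiHat B u M δ t k := by
  obtain ⟨hkt, hmin⟩ := hkhat
  have hφk : phiHat B u M δ t k ≤ 2 * b := phiHat_le hk.1 h hb
  have hopt := hmin k hk
  have hφ0 (r : ℕ) : 0 ≤ phiHat B u M δ t r := phiHat_nonneg
  have hdist : |windowMean B u t khat - windowMean B u t k| ≤ 4 * b + 2 * psiHat B u M δ t k := by
    rcases le_total k khat with hle | hle
    · linarith [abs_windowMean_sub_windowMean_le_phiHat_add (B := B) (u := u) (M := M) (δ := δ)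
        (t := t) ⟨hk.1, hle⟩, hφ0 khat]
    · rw [abs_sub_comm]
      linarith [abs_windowMean_sub_windowMean_le_phiHat_add (B := B) (u := u) (M := M) (δ := δ)
        (t := t) ⟨hkt.1, hle⟩, hφ0 khat]
  linarith [abs_sub_le (windowMean B u t khat) (windowMean B u t k) θ, h k ⟨hk.1, le_rfl⟩]

end AdaptiveWindow

end Window

section L2

variable {X : Type*} [MeasurableSpace X] {Q : Measure X} {f g r s : X → ℝ}

lemma normL2_nonneg (f : X → ℝ) : 0 ≤ normL2 Q f := Real.sqrt_nonneg _

lemma integral_mul_eq_inner_toLp (hf : MemLp f 2 Q) (hg : MemLp g 2 Q) :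
    ∫ x, f x * g x ∂Q = inner ℝ (hf.toLp f) (hg.toLp g) := by
  rw [L2.inner_def]
  refine integral_congr_ae ?_
  filter_upwards [hf.coeFn_toLp, hg.coeFn_toLp] with x hfx hgx
  rw [hfx, hgx, Real.inner_apply]

lemma normL2_eq_norm_toLp (hf : MemLp f 2 Q) : normL2 Q f = ‖hf.toLp f‖ := by
  rw [normL2, integral_mul_eq_inner_toLp hf hf, real_inner_self_eq_norm_sq,
    Real.sqrt_sq (norm_nonneg _)]

lemma normL2_sub_eq_norm_toLp_sub (hf : MemLp f 2 Q) (hg : MemLp g 2 Q) :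
    normL2 Q (fun x => f x - g x) = ‖hf.toLp f - hg.toLp g‖ := by
  rw [← MemLp.toLp_sub]
  exact normL2_eq_norm_toLp (hf.sub hg)

lemma normL2_sub_le_add (hf : MemLp f 2 Q) (hg : MemLp g 2 Q) (hr : MemLp r 2 Q) :
    normL2 Q (fun x => f x - g x) ≤
      normL2 Q (fun x => f x - r x) + normL2 Q (fun x => g x - r x) := by
  rw [normL2_sub_eq_norm_toLp_sub hf hg, normL2_sub_eq_norm_toLp_sub hf hr,
    normL2_sub_eq_norm_toLp_sub hg hr, norm_sub_rev (hg.toLp g)]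
  exact norm_sub_le_norm_sub_add_norm_sub _ _ _

lemma abs_norm_sub_sq_sub_sub_le {E : Type*} [NormedAddCommGroup E] [InnerProductSpace ℝ E]
    (a b c d : E) :
    |(‖a - c‖ ^ 2 - ‖b - c‖ ^ 2) - (‖a - d‖ ^ 2 - ‖b - d‖ ^ 2)| ≤ 2 * (‖a - b‖ * ‖c - d‖) := by
  have hpolar : (‖a - c‖ ^ 2 - ‖b - c‖ ^ 2) - (‖a - d‖ ^ 2 - ‖b - d‖ ^ 2) =
      -2 * inner ℝ (a - b) (c - d) := by
    simp only [norm_sub_sq_real, inner_sub_left, inner_sub_right]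
    ring
  rw [hpolar, abs_mul, abs_neg, abs_two]
  gcongr
  exact abs_real_inner_le_norm _ _

lemma abs_normL2_sub_sq_sub_sub_le (hf : MemLp f 2 Q) (hg : MemLp g 2 Q) (hr : MemLp r 2 Q)
    (hs : MemLp s 2 Q) :
    |(normL2 Q (fun x => f x - r x) ^ 2 - normL2 Q (fun x => g x - r x) ^ 2) -
        (normL2 Q (fun x => f x - s x) ^ 2 - normL2 Q (fun x => g x - s x) ^ 2)| ≤
      2 * (normL2 Q (fun x => f x - g x) * normL2 Q (fun x => r x - s x)) := by
  rw [normL2_sub_eq_norm_toLp_sub hf hr, normL2_sub_eq_norm_toLp_sub hg hr,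
    normL2_sub_eq_norm_toLp_sub hf hs, normL2_sub_eq_norm_toLp_sub hg hs,
    normL2_sub_eq_norm_toLp_sub hf hg, normL2_sub_eq_norm_toLp_sub hr hs]
  exact abs_norm_sub_sq_sub_sub_le _ _ _ _

end L2

section Regression

variable {X : Type*} [MeasurableSpace X] {P : Measure (X × ℝ)}

lemma memLp_fst {f : X → ℝ} (hf : MemLp f 2 P.fst) : MemLp (fun z => f z.1) 2 P :=
  hf.comp_measurePreserving (measurable_fst.measurePreserving P)

lemma normL2_fst_sq {f : X → ℝ} (hf : AEStronglyMeasurable f P.fst) :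
    normL2 P.fst f ^ 2 = ∫ z, f z.1 * f z.1 ∂P := by
  rw [normL2, Real.sq_sqrt (integral_nonneg fun _ => mul_self_nonneg _)]
  exact integral_map measurable_fst.aemeasurable (hf.mul hf)

variable [IsFiniteMeasure P]

lemma measurable_regressionFn : Measurable (regressionFn P) :=
  (StronglyMeasurable.integral_kernel (κ := P.condKernel)
    measurable_id.stronglyMeasurable).measurable

lemma condDistrib_snd_fst : condDistrib Prod.snd Prod.fst P =ᵐ[P.fst] P.condKernel := by
  refine (condDistrib_ae_eq_iff_measure_eq_compProd _ measurable_snd.aemeasurable _).2 ?_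
  simp only [Prod.mk.eta, Measure.map_id']
  exact (P.disintegrate P.condKernel).symm

lemma regressionFn_fst_ae_eq_condExp (hy : Integrable Prod.snd P) :
    (fun z => regressionFn P z.1) =ᵐ[P]
      P[Prod.snd | MeasurableSpace.comap Prod.fst inferInstance] := by
  refine .trans ?_ (condExp_ae_eq_integral_condDistrib' measurable_fst hy).symm
  filter_upwards [ae_of_ae_map measurable_fst.aemeasurable condDistrib_snd_fst] with z hz
  rw [regressionFn, hz]

lemma memLp_regressionFn (hy : MemLp Prod.snd 2 P) : MemLp (regressionFn P) 2 P.fst := by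
  refine (memLp_map_measure_iff measurable_regressionFn.aestronglyMeasurable
    measurable_fst.aemeasurable).2 ?_
  exact (memLp_congr_ae (regressionFn_fst_ae_eq_condExp (hy.integrable one_le_two))).2
    (hy.condExp one_le_two)

lemma integral_fst_mul_snd {g : X → ℝ} (hg : MemLp g 2 P.fst) (hy : MemLp Prod.snd 2 P) :
    ∫ z, g z.1 * z.2 ∂P = ∫ z, g z.1 * regressionFn P z.1 ∂P := by
  calc ∫ z, g z.1 * z.2 ∂P = ∫ x, ∫ y, g x * y ∂P.condKernel x ∂P.fst :=
        (Measure.integral_condKernel ((memLp_fst hg).integrable_mul hy)).symm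
    _ = ∫ x, g x * regressionFn P x ∂P.fst :=
        integral_congr_ae (ae_of_all _ fun x => integral_const_mul (g x) id)
    _ = ∫ z, g z.1 * regressionFn P z.1 ∂P := integral_map measurable_fst.aemeasurable
        (hg.aestronglyMeasurable.mul measurable_regressionFn.aestronglyMeasurable)

theorem risk_sub_risk_regressionFn {f : X → ℝ} {Q : Measure X} (hQ : P.fst = Q)
    (hf : MemLp f 2 Q) (hy : MemLp Prod.snd 2 P) :
    risk P f - risk P (regressionFn P) = normL2 Q (fun x => f x - regressionFn P x) ^ 2 := by
  subst hQ
  set r := regressionFn P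
  have hr : MemLp r 2 P.fst := memLp_regressionFn hy
  have hd : MemLp (fun x => f x - r x) 2 P.fst := hf.sub hr
  have hdr : Integrable (fun z => (f z.1 - r z.1) * r z.1) P :=
    (memLp_fst hd).integrable_mul (memLp_fst hr)
  have hdy : Integrable (fun z => (f z.1 - r z.1) * z.2) P := (memLp_fst hd).integrable_mul hy
  have hdd : Integrable (fun z => (f z.1 - r z.1) * (f z.1 - r z.1)) P :=
    (memLp_fst hd).integrable_mul (memLp_fst hd)
  have hrest : Integrable (fun z => 2 * ((f z.1 - r z.1) * r z.1 - (f z.1 - r z.1) * z.2)) P :=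
    (hdr.sub hdy).const_mul 2
  have hcross : ∫ z, 2 * ((f z.1 - r z.1) * r z.1 - (f z.1 - r z.1) * z.2) ∂P = 0 := by
    rw [integral_const_mul, integral_sub hdr hdy, integral_fst_mul_snd hd hy, sub_self, mul_zero]
  have hint {g : X → ℝ} (hg : MemLp g 2 P.fst) : Integrable (sqLoss g) P :=
    ((memLp_fst hg).sub hy).integrable_sq
  calc risk P f - risk P r = ∫ z, (sqLoss f z - sqLoss r z) ∂P :=
        (integral_sub (hint hf) (hint hr)).symm
    _ = ∫ z, ((f z.1 - r z.1) * (f z.1 - r z.1) +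
          2 * ((f z.1 - r z.1) * r z.1 - (f z.1 - r z.1) * z.2)) ∂P := by
        congr with z
        simp only [sqLoss]
        ring
    _ = normL2 P.fst (fun x => f x - r x) ^ 2 := by
        rw [integral_add hdd hrest, hcross, add_zero, normL2_fst_sq hd.aestronglyMeasurable]

theorem abs_risk_sub_risk_sub_le {P' : Measure (X × ℝ)} [IsFiniteMeasure P'] {Q : Measure X}
    {f g : X → ℝ} (hQ : P.fst = Q) (hQ' : P'.fst = Q) (hf : MemLp f 2 Q) (hg : MemLp g 2 Q)
    (hy : MemLp Prod.snd 2 P) (hy' : MemLp Prod.snd 2 P') :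
    |(risk P f - risk P g) - (risk P' f - risk P' g)| ≤
      2 * (normL2 Q (fun x => f x - g x) *
        normL2 Q (fun x => regressionFn P x - regressionFn P' x)) := by
  have hdiff {R : Measure (X × ℝ)} [IsFiniteMeasure R] (hR : R.fst = Q)
      (hyR : MemLp Prod.snd 2 R) : risk R f - risk R g =
        normL2 Q (fun x => f x - regressionFn R x) ^ 2 -
          normL2 Q (fun x => g x - regressionFn R x) ^ 2 := by
    rw [← risk_sub_risk_regressionFn hR hf hyR, ← risk_sub_risk_regressionFn hR hg hyR,
      sub_sub_sub_cancel_right]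
  rw [hdiff hQ hy, hdiff hQ' hy']
  exact abs_normL2_sub_sq_sub_sub_le hf hg (hQ ▸ memLp_regressionFn hy)
    (hQ' ▸ memLp_regressionFn hy')

end Regression

section SqLossDiff

variable {X : Type*} {f g : X → ℝ} {K : ℝ}

lemma abs_sqLoss_sub_sqLoss_le {z : X × ℝ} (hf : |f z.1| ≤ K) (hg : |g z.1| ≤ K)
    (hz : |z.2| ≤ K) : |sqLoss f z - sqLoss g z| ≤ 4 * K * |f z.1 - g z.1| := by
  have hfactor : sqLoss f z - sqLoss g z = (f z.1 + g z.1 - 2 * z.2) * (f z.1 - g z.1) := by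
    simp only [sqLoss]
    ring
  rw [hfactor, abs_mul]
  gcongr
  rw [abs_le] at *
  constructor <;> linarith

lemma abs_sqLoss_sub_sqLoss_le_sq {z : X × ℝ} (hf : |f z.1| ≤ K) (hg : |g z.1| ≤ K)
    (hz : |z.2| ≤ K) : |sqLoss f z - sqLoss g z| ≤ 4 * K ^ 2 := by
  rw [abs_le] at *
  simp only [sqLoss]
  constructor <;> nlinarith

variable [MeasurableSpace X]

lemma measurable_sqLoss (hf : Measurable f) : Measurable (sqLoss f) :=
  ((hf.comp measurable_fst).sub measurable_snd).pow_const 2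

lemma memLp_two_of_abs_le {Q : Measure X} [IsFiniteMeasure Q] (hf : Measurable f)
    (hK : ∀ x, |f x| ≤ K) : MemLp f 2 Q :=
  .of_bound hf.aestronglyMeasurable K (ae_of_all _ hK)

lemma integral_sqLoss_sub_sqLoss {P : Measure (X × ℝ)} (hf : MemLp f 2 P.fst)
    (hg : MemLp g 2 P.fst) (hy : MemLp Prod.snd 2 P) :
    ∫ z, (sqLoss f z - sqLoss g z) ∂P = risk P f - risk P g :=
  integral_sub ((memLp_fst hf).sub hy).integrable_sq ((memLp_fst hg).sub hy).integrable_sq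

lemma integral_sqLoss_sub_sqLoss_sq_le {P : Measure (X × ℝ)} {Q : Measure X} (hQ : P.fst = Q)
    (hf : MemLp f 2 Q) (hg : MemLp g 2 Q) (hfK : ∀ x, |f x| ≤ K) (hgK : ∀ x, |g x| ≤ K)
    (hy : ∀ᵐ z ∂P, |z.2| ≤ K) :
    ∫ z, (sqLoss f z - sqLoss g z) ^ 2 ∂P ≤ 16 * K ^ 2 * normL2 Q (fun x => f x - g x) ^ 2 := by
  subst hQ
  have hd : MemLp (fun x => f x - g x) 2 P.fst := hf.sub hg
  rw [normL2_fst_sq hd.aestronglyMeasurable, ← integral_const_mul]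
  refine integral_mono_of_nonneg (ae_of_all _ fun _ => sq_nonneg _)
    (((memLp_fst hd).integrable_mul (memLp_fst hd)).const_mul _) ?_
  filter_upwards [hy] with z hz
  calc (sqLoss f z - sqLoss g z) ^ 2 = |sqLoss f z - sqLoss g z| ^ 2 := (sq_abs _).symm
    _ ≤ (4 * K * |f z.1 - g z.1|) ^ 2 := by
        gcongr
        exact abs_sqLoss_sub_sqLoss_le (hfK _) (hgK _) hz
    _ = 16 * K ^ 2 * ((f z.1 - g z.1) * (f z.1 - g z.1)) := by
        rw [mul_pow, sq_abs]
        ring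

end SqLossDiff

section FastRate

lemma sub_le_add_of_sq_sub_sq_le {d e ρ σ : ℝ} (he : 0 ≤ e) (hρ : 0 ≤ ρ) (hσ : 0 ≤ σ)
    (h : d ^ 2 - e ^ 2 ≤ (d + e) * ρ + σ ^ 2) : d - e ≤ ρ + σ := by
  by_contra! hlt
  have hsum : σ < d + e := by linarith
  have hdiff : σ < d - e - ρ := by linarith
  nlinarith [mul_lt_mul'' hsum hdiff hσ hσ]

lemma sub_min_le_and_sq_le {d e R : ℝ} (hd : 0 ≤ d) (hR : 0 ≤ R) (h : d - e ≤ R) :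
    d - min d e ≤ R ∧ d ^ 2 ≤ 2 * min (d ^ 2) (e ^ 2) + 2 * R ^ 2 := by
  constructor
  · rw [sub_le_comm]
    exact le_min (by linarith) (by linarith)
  · have hsq : d ^ 2 ≤ 2 * e ^ 2 + 2 * R ^ 2 := by
      calc d ^ 2 ≤ (e + R) ^ 2 := by gcongr; linarith
        _ ≤ 2 * (e ^ 2 + R ^ 2) := add_sq_le
        _ = 2 * e ^ 2 + 2 * R ^ 2 := mul_add _ _ _
    rw [mul_min_of_nonneg _ _ zero_le_two, ← min_add_add_right]
    exact le_min (by nlinarith) hsq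

variable {X : Type*} {f₁ f₂ fhat : X → ℝ} {B : ℕ → ℕ} {t k : ℕ}

lemma IsComparisonOutput.eq_or_eq {z : ℕ → ℕ → X × ℝ} {M δ : ℝ}
    (hfhat : IsComparisonOutput f₁ f₂ B z M δ t fhat) : fhat = f₁ ∨ fhat = f₂ := by
  obtain ⟨k, -, h⟩ := hfhat
  exact h.imp And.right And.right

theorem IsComparisonOutput.sub_min_le_and_sq_le {z : ℕ → ℕ → X × ℝ} {M δ ρ σ : ℝ}
    {d : (X → ℝ) → ℝ} (hd : ∀ f, 0 ≤ d f) (hρ : 0 ≤ ρ) (hσ : 0 ≤ σ)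
    (h : ∀ k, IsAdaptiveWindow B (fun j i => sqLoss f₁ (z j i) - sqLoss f₂ (z j i)) M δ t k →
      |windowMean B (fun j i => sqLoss f₁ (z j i) - sqLoss f₂ (z j i)) t k -
        (d f₁ ^ 2 - d f₂ ^ 2)| ≤ (d f₁ + d f₂) * ρ + σ ^ 2)
    (hfhat : IsComparisonOutput f₁ f₂ B z M δ t fhat) :
    d fhat - min (d f₁) (d f₂) ≤ ρ + σ ∧
      d fhat ^ 2 ≤ 2 * min (d f₁ ^ 2) (d f₂ ^ 2) + 2 * (ρ + σ) ^ 2 := by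
  obtain ⟨k, hk, ⟨hmean, rfl⟩ | ⟨hmean, rfl⟩⟩ := hfhat
  · refine RollingWindow.sub_min_le_and_sq_le (hd _) (add_nonneg hρ hσ)
      (sub_le_add_of_sq_sub_sq_le (hd _) hρ hσ ?_)
    linarith [(abs_le.1 (h k hk)).1]
  · rw [min_comm (d f₁), min_comm (d f₁ ^ 2)]
    refine RollingWindow.sub_min_le_and_sq_le (hd _) (add_nonneg hρ hσ)
      (sub_le_add_of_sq_sub_sq_le (hd _) hρ hσ ?_)
    linarith [(abs_le.1 (h k hk)).2]

lemma IsAdaptiveWindow.abs_windowMean_sub_le_mul_add_sq {u : ℕ → ℕ → ℝ} {khat : ℕ}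
    {K H D A a θ δ : ℝ} (hkhat : IsAdaptiveWindow B u (8 * K ^ 2) δ t khat) (hk : k ∈ Set.Icc 1 t)
    (hK : 0 ≤ K) (hH : 0 ≤ H) (hHD : H ≤ D) (hA : 0 ≤ A) (ha : 0 ≤ a)
    (h : ∀ i ∈ Set.Icc 1 k, |windowMean B u t i - θ| ≤ 2 * (H * A) + psiHat B u (8 * K ^ 2) δ t i)
    (hψ : psiHat B u (8 * K ^ 2) δ t k ≤ 3 * √a * √(16 * K ^ 2 * H ^ 2) + 7 * (8 * K ^ 2) * a) :
    |windowMean B u t khat - θ| ≤ D * (36 * (A + √a * K)) + (13 * (A + √a * K)) ^ 2 := by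
  have hsqrt : √(16 * K ^ 2 * H ^ 2) = 4 * K * H := by
    rw [show 16 * K ^ 2 * H ^ 2 = (4 * K * H) ^ 2 by ring, Real.sqrt_sq (by positivity)]
  rw [hsqrt] at hψ
  have hlin : H * (A + √a * K) ≤ D * (A + √a * K) := by gcongr
  have hquad : a * K ^ 2 ≤ (A + √a * K) ^ 2 := by
    calc a * K ^ 2 = (√a * K) ^ 2 := by rw [mul_pow, Real.sq_sqrt ha]
      _ ≤ (A + √a * K) ^ 2 := by gcongr; exact le_add_of_nonneg_left hA
  have horacle := hkhat.abs_windowMean_sub_le hk (by positivity) h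
  nlinarith [mul_nonneg hH hA]

variable [MeasurableSpace X] {P : ℕ → Measure (X × ℝ)} [∀ j, IsProbabilityMeasure (P j)]
  {Q : Measure X}

lemma maxShift_nonneg : 0 ≤ maxShift P Q t k := Real.iSup_nonneg fun _ => normL2_nonneg _

lemma normL2_regressionFn_sub_le_maxShift {j : ℕ} (hj : j ∈ Set.Icc (t - k + 1) t) :
    normL2 Q (fun x => regressionFn (P j) x - regressionFn (P t) x) ≤ maxShift P Q t k :=
  le_ciSup (f := fun j : Set.Icc (t - k + 1) t =>
    normL2 Q fun x => regressionFn (P j) x - regressionFn (P t) x)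
    (Set.finite_range _).bddAbove ⟨j, hj⟩

lemma abs_windowMean_risk_sub_le {i : ℕ} (hB : ∀ j, 1 ≤ j → 1 ≤ B j)
    (hQ : ∀ j, 1 ≤ j → (P j).fst = Q) (hy : ∀ j, 1 ≤ j → MemLp Prod.snd 2 (P j))
    (hf₁ : MemLp f₁ 2 Q) (hf₂ : MemLp f₂ 2 Q) (hk : k ∈ Set.Icc 1 t) (hi : i ∈ Set.Icc 1 k) :
    |windowMean B (fun j _ => risk (P j) f₁ - risk (P j) f₂) t i -
        (risk (P t) f₁ - risk (P t) f₂)| ≤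
      2 * (normL2 Q (fun x => f₁ x - f₂ x) * maxShift P Q t k) := by
  rw [Set.mem_Icc] at hk hi
  refine abs_windowMean_sub_le (windowSize_pos hB ⟨hi.1, hi.2.trans hk.2⟩) fun p hp => ?_
  have hp1 := Finset.mem_Icc.1 (mem_windowIndex.1 hp).1
  have hp' : 1 ≤ p.1 := by omega
  have ht : 1 ≤ t := hk.1.trans hk.2
  refine (abs_risk_sub_risk_sub_le (hQ _ hp') (hQ t ht) hf₁ hf₂ (hy _ hp') (hy t ht)).trans ?_
  gcongr
  · exact normL2_nonneg _
  · exact normL2_regressionFn_sub_le_maxShift ⟨by omega, hp1.2⟩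

theorem IsComparisonOutput.normL2_sub_min_le_and_sq_le {z : ℕ → ℕ → X × ℝ} {K δ : ℝ}
    (hB : ∀ j, 1 ≤ j → 1 ≤ B j) (hQ : ∀ j, 1 ≤ j → (P j).fst = Q)
    (hy : ∀ j, 1 ≤ j → MemLp Prod.snd 2 (P j)) (hf₁ : MemLp f₁ 2 Q) (hf₂ : MemLp f₂ 2 Q)
    (hK : 0 ≤ K) (hδ : δ ∈ Set.Ioo (0 : ℝ) 1)
    (h : WindowsAccurate B (fun j i => sqLoss f₁ (z j i) - sqLoss f₂ (z j i))
      (fun j _ => risk (P j) f₁ - risk (P j) f₂) (8 * K ^ 2)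
      (16 * K ^ 2 * normL2 Q (fun x => f₁ x - f₂ x) ^ 2) δ t)
    (hfhat : IsComparisonOutput f₁ f₂ B z (8 * K ^ 2) (δ / (3 * t)) t fhat)
    (hk : k ∈ Set.Icc 1 t) :
    normL2 Q (fun x => fhat x - regressionFn (P t) x) -
        min (normL2 Q fun x => f₁ x - regressionFn (P t) x)
          (normL2 Q fun x => f₂ x - regressionFn (P t) x) ≤
      49 * (maxShift P Q t k + √(Real.log (6 * t / δ) / windowSize B t k) * K) ∧
    risk (P t) fhat - risk (P t) (regressionFn (P t)) ≤
      2 * min (risk (P t) f₁ - risk (P t) (regressionFn (P t)))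
        (risk (P t) f₂ - risk (P t) (regressionFn (P t))) +
      2 * (49 * (maxShift P Q t k + √(Real.log (6 * t / δ) / windowSize B t k) * K)) ^ 2 := by
  have ht : 1 ≤ t := hk.1.trans hk.2
  have hr : MemLp (regressionFn (P t)) 2 Q := hQ t ht ▸ memLp_regressionFn (hy t ht)
  have hexcess {f : X → ℝ} (hf : MemLp f 2 Q) := risk_sub_risk_regressionFn (hQ t ht) hf (hy t ht)
  have hfhatQ : MemLp fhat 2 Q := by
    rcases hfhat.eq_or_eq with rfl | rfl <;> assumption
  have hlog := zero_le_one.trans (one_le_log_six_mul_div ht hδ)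
  have hrate : 0 ≤ maxShift P Q t k + √(Real.log (6 * t / δ) / windowSize B t k) * K :=
    add_nonneg maxShift_nonneg (by positivity)
  rw [hexcess hfhatQ, hexcess hf₁, hexcess hf₂, show (49 : ℝ) = 36 + 13 by norm_num, add_mul]
  refine hfhat.sub_min_le_and_sq_le (d := fun f => normL2 Q fun x => f x - regressionFn (P t) x)
    (fun f => normL2_nonneg _) (mul_nonneg (by norm_num) hrate)
    (mul_nonneg (by norm_num) hrate) fun khat hkhat => ?_
  rw [← hexcess hf₁, ← hexcess hf₂, sub_sub_sub_cancel_right]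
  refine hkhat.abs_windowMean_sub_le_mul_add_sq hk hK (normL2_nonneg _)
    (normL2_sub_le_add hf₁ hf₂ hr) maxShift_nonneg (by positivity) (fun i hi => ?_)
    (h k (Finset.mem_Icc.2 hk)).2
  refine (abs_sub_le _ _ _).trans ((add_comm _ _).trans_le (add_le_add
    (abs_windowMean_risk_sub_le hB hQ hy hf₁ hf₂ hk hi)
    (h i (Finset.mem_Icc.2 ⟨hi.1, hi.2.trans hk.2⟩)).1))

lemma add_sqrt_div_mul_le {A K x n : ℝ} (hA : 0 ≤ A) (hx : 1 ≤ x) :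
    A + √(x / n) * K ≤ √x * (A + K / √n) := by
  rw [Real.sqrt_div (zero_le_one.trans hx), mul_add, div_mul_eq_mul_div, mul_div_assoc]
  gcongr
  exact le_mul_of_one_le_left hA (Real.one_le_sqrt.2 hx)

lemma add_sqrt_div_mul_sq_le {A K x n : ℝ} (hx : 1 ≤ x) (hn : 0 ≤ n) :
    (A + √(x / n) * K) ^ 2 ≤ 2 * (x * (A ^ 2 + K ^ 2 / n)) := by
  refine add_sq_le.trans ?_
  rw [mul_pow, Real.sq_sqrt (by positivity), mul_add x, div_mul_eq_mul_div, mul_div_assoc]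
  gcongr
  exact le_mul_of_one_le_left (sq_nonneg A) hx

theorem IsComparisonOutput.fast_rate {z : ℕ → ℕ → X × ℝ} {K δ : ℝ}
    (hB : ∀ j, 1 ≤ j → 1 ≤ B j) (hQ : ∀ j, 1 ≤ j → (P j).fst = Q)
    (hy : ∀ j, 1 ≤ j → MemLp Prod.snd 2 (P j)) (hf₁ : MemLp f₁ 2 Q) (hf₂ : MemLp f₂ 2 Q)
    (hK : 0 ≤ K) (hδ : δ ∈ Set.Ioo (0 : ℝ) 1)
    (h : WindowsAccurate B (fun j i => sqLoss f₁ (z j i) - sqLoss f₂ (z j i))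
      (fun j _ => risk (P j) f₁ - risk (P j) f₂) (8 * K ^ 2)
      (16 * K ^ 2 * normL2 Q (fun x => f₁ x - f₂ x) ^ 2) δ t)
    (hfhat : IsComparisonOutput f₁ f₂ B z (8 * K ^ 2) (δ / (3 * t)) t fhat)
    (hk : k ∈ Set.Icc 1 t) :
    normL2 Q (fun x => fhat x - regressionFn (P t) x) -
        min (normL2 Q fun x => f₁ x - regressionFn (P t) x)
          (normL2 Q fun x => f₂ x - regressionFn (P t) x) ≤
      49 * √(Real.log (6 * t / δ)) * (maxShift P Q t k + K / √(windowSize B t k)) ∧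
    risk (P t) fhat - risk (P t) (regressionFn (P t)) ≤
      2 * min (risk (P t) f₁ - risk (P t) (regressionFn (P t)))
        (risk (P t) f₂ - risk (P t) (regressionFn (P t))) +
      4 * 49 ^ 2 * Real.log (6 * t / δ) * (maxShift P Q t k ^ 2 + K ^ 2 / windowSize B t k) := by
  have hlog := one_le_log_six_mul_div (hk.1.trans hk.2) hδ
  have hA : 0 ≤ maxShift P Q t k := maxShift_nonneg
  have hrate := add_sqrt_div_mul_le (K := K) (n := windowSize B t k) hA hlog
  have hrate_sq := add_sqrt_div_mul_sq_le (A := maxShift P Q t k) (K := K) hlog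
    (Nat.cast_nonneg (windowSize B t k))
  obtain ⟨hnorm, hrisk⟩ := hfhat.normL2_sub_min_le_and_sq_le hB hQ hy hf₁ hf₂ hK hδ h hk
  constructor <;> linarith

theorem one_sub_le_measureReal_windowsAccurate_sqLoss {Ω : Type*} [MeasurableSpace Ω]
    {μ : Measure Ω} [IsProbabilityMeasure μ] {z : ℕ → ℕ → Ω → X × ℝ} {K δ : ℝ}
    [IsFiniteMeasure Q] (ht : 1 ≤ t) (hB : ∀ j, 1 ≤ j → 1 ≤ B j) (hδ : δ ∈ Set.Ioo (0 : ℝ) 1)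
    (hQ : ∀ j, 1 ≤ j → (P j).fst = Q) (hy : ∀ j, 1 ≤ j → ∀ᵐ z ∂(P j), |z.2| ≤ K)
    (hK : 0 < K) (hf₁ : Measurable f₁) (hf₂ : Measurable f₂)
    (hf₁K : ∀ x, |f₁ x| ≤ K) (hf₂K : ∀ x, |f₂ x| ≤ K)
    (hz : ∀ j ∈ Set.Icc 1 t, ∀ i ∈ Set.Icc 1 (B j), Measurable (z j i) ∧ μ.map (z j i) = P j)
    (hind : iIndepFun (fun p : {p : ℕ × ℕ // p.1 ∈ Set.Icc 1 t ∧ p.2 ∈ Set.Icc 1 (B p.1)} =>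
      z p.1.1 p.1.2) μ) :
    1 - δ ≤ μ.real {ω | WindowsAccurate B (fun j i => sqLoss f₁ (z j i ω) - sqLoss f₂ (z j i ω))
      (fun j _ => risk (P j) f₁ - risk (P j) f₂) (8 * K ^ 2)
      (16 * K ^ 2 * normL2 Q (fun x => f₁ x - f₂ x) ^ 2) δ t} := by
  have hsub : ∀ p ∈ windowIndex B t t, p.1 ∈ Set.Icc 1 t ∧ p.2 ∈ Set.Icc 1 (B p.1) := by
    simp [mem_windowIndex]
  have hz' := fun p hp => hz p.1 (hsub p hp).1 p.2 (hsub p hp).2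
  have hℓ : Measurable fun z : X × ℝ => sqLoss f₁ z - sqLoss f₂ z :=
    (measurable_sqLoss hf₁).sub (measurable_sqLoss hf₂)
  have hmap : ∀ p ∈ windowIndex B t t, ∀ {g : X × ℝ → ℝ}, Measurable g →
      ∫ ω, g (z p.1 p.2 ω) ∂μ = ∫ w, g w ∂(P p.1) := fun p hp g hg => by
    rw [← (hz' p hp).2, integral_map (hz' p hp).1.aemeasurable hg.aestronglyMeasurable]
  have hmean : ∀ k, windowMean B
      (fun j i => ∫ ω, (sqLoss f₁ (z j i ω) - sqLoss f₂ (z j i ω)) ∂μ) t k =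
      windowMean B (fun j _ => risk (P j) f₁ - risk (P j) f₂) t k := fun k =>
    windowMean_congr fun p hp => by
      have hp' := windowIndex_subset hp
      have hj := (hsub p hp').1.1
      rw [hmap p hp' hℓ, integral_sqLoss_sub_sqLoss (memLp_two_of_abs_le hf₁ hf₁K)
        (memLp_two_of_abs_le hf₂ hf₂K)
        (.of_bound measurable_snd.aestronglyMeasurable K (hy _ hj))]
  simp only [WindowsAccurate, ← hmean]
  refine one_sub_le_measureReal_windowsAccurate ht hB (by positivity) (by positivity) hδ
    (fun p hp => hℓ.comp (hz' p hp).1) ?_ (fun p hp => ?_) (fun p hp => ?_)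
  · refine (hind.precomp (g := fun p : windowIndex B t t => ⟨(p.1.1, p.1.2), hsub p.1 p.2⟩)
      fun p q hpq => ?_).comp (fun _ z => sqLoss f₁ z - sqLoss f₂ z) fun _ => hℓ
    simp only [Subtype.mk.injEq, Prod.mk.injEq] at hpq
    exact Subtype.ext (Sigma.ext hpq.1 (heq_of_eq hpq.2))
  · refine ae_of_ae_map (hz' p hp).1.aemeasurable (p := fun w => |sqLoss f₁ w - sqLoss f₂ w| ≤ _) ?_
    rw [(hz' p hp).2]
    filter_upwards [hy _ (hsub p hp).1.1] with w hw
    linarith [abs_sqLoss_sub_sqLoss_le_sq (hf₁K w.1) (hf₂K w.1) hw]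
  · have hj := (hsub p hp).1.1
    rw [hmap p hp (hℓ.pow_const 2)]
    exact integral_sqLoss_sub_sqLoss_sq_le (hQ _ hj) (memLp_two_of_abs_le hf₁ hf₁K)
      (memLp_two_of_abs_le hf₂ hf₂K) hf₁K hf₂K (hy _ hj)

lemma le_mul_iInf_window {a c : ℝ} {g : ℕ → ℝ} (ht : 1 ≤ t) (hc : 0 ≤ c)
    (h : ∀ k ∈ Set.Icc 1 t, a ≤ c * g k) : a ≤ c * ⨅ k : Set.Icc 1 t, g k := by
  have : Nonempty (Set.Icc 1 t) := ⟨⟨1, le_rfl, ht⟩⟩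
  rw [Real.mul_iInf_of_nonneg hc]
  exact le_ciInf fun k => h k k.2

end FastRate

end RollingWindow

open RollingWindow

theorem mainTheorem3 :
    ∃ C : ℝ, 0 < C ∧
      ∀ (X : Type*) [MeasurableSpace X]
        -- the distributions `P 1, P 2, …` of `(x, y)`; the index `0` is not used
        (P : ℕ → Measure (X × ℝ)) [∀ j, IsProbabilityMeasure (P j)]
        (M₀ : ℝ) (_ : 0 < M₀)
        -- bounded responses
        (_ : ∀ j, 1 ≤ j → ∀ᵐ z ∂(P j), |z.2| ≤ M₀)
        -- no covariate shift: `Q` is the common marginal distribution of the covariate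
        (Q : Measure X) (_ : ∀ j, 1 ≤ j → (P j).map Prod.fst = Q)
        -- the two bounded candidate models
        (f₁ f₂ : X → ℝ) (_ : Measurable f₁) (_ : Measurable f₂)
        (_ : ∀ x, |f₁ x| ≤ M₀) (_ : ∀ x, |f₂ x| ≤ M₀)
        -- current time and batch sizes
        (t : ℕ) (_ : 1 ≤ t) (B : ℕ → ℕ) (_ : ∀ j, 1 ≤ j → 1 ≤ B j)
        -- independent samples `z j i ∼ P j` for `1 ≤ j ≤ t`, `1 ≤ i ≤ B j`
        (Ω : Type*) [MeasurableSpace Ω] (μ : Measure Ω) [IsProbabilityMeasure μ]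
        (z : ℕ → ℕ → Ω → X × ℝ)
        (_ : ∀ j ∈ Set.Icc 1 t, ∀ i ∈ Set.Icc 1 (B j), Measurable (z j i) ∧ μ.map (z j i) = P j)
        (_ : iIndepFun
          (fun p : {p : ℕ × ℕ // p.1 ∈ Set.Icc 1 t ∧ p.2 ∈ Set.Icc 1 (B p.1)} =>
            z p.1.1 p.1.2) μ)
        (δ : ℝ) (_ : δ ∈ Set.Ioo (0 : ℝ) 1),
        1 - δ ≤ μ.real {ω | ∀ fhat : X → ℝ,
          RollingWindow.IsComparisonOutput f₁ f₂ B (fun j i => z j i ω)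
              (8 * M₀ ^ 2) (δ / (3 * (t : ℝ))) t fhat →
            RollingWindow.normL2 Q (fun x => fhat x - RollingWindow.regressionFn (P t) x) -
                min (RollingWindow.normL2 Q (fun x => f₁ x - RollingWindow.regressionFn (P t) x))
                  (RollingWindow.normL2 Q (fun x => f₂ x - RollingWindow.regressionFn (P t) x))
              ≤ C * √(Real.log (6 * (t : ℝ) / δ)) *
                ⨅ k : Set.Icc 1 t, (RollingWindow.maxShift P Q t k +
                  M₀ / √(RollingWindow.windowSize B t k : ℝ)) ∧
            RollingWindow.risk (P t) fhat -
                RollingWindow.risk (P t) (RollingWindow.regressionFn (P t))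
              ≤ 2 * min
                  (RollingWindow.risk (P t) f₁ -
                    RollingWindow.risk (P t) (RollingWindow.regressionFn (P t)))
                  (RollingWindow.risk (P t) f₂ -
                    RollingWindow.risk (P t) (RollingWindow.regressionFn (P t))) +
                C * Real.log (6 * (t : ℝ) / δ) *
                  ⨅ k : Set.Icc 1 t, (RollingWindow.maxShift P Q t k ^ 2 +
                    M₀ ^ 2 / (RollingWindow.windowSize B t k : ℝ))} := by
  refine ⟨4 * 49 ^ 2, by norm_num, fun X _ P _ M₀ hM₀ hy Q hQ f₁ f₂ hf₁ hf₂ hf₁M hf₂M t ht B hB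
    Ω _ μ _ z hz hind δ hδ => ?_⟩
  have hQprob : IsProbabilityMeasure Q :=
    hQ 1 le_rfl ▸ Measure.isProbabilityMeasure_map measurable_fst.aemeasurable
  have hyL2 (j) (hj : 1 ≤ j) : MemLp Prod.snd 2 (P j) :=
    .of_bound measurable_snd.aestronglyMeasurable M₀ (hy j hj)
  have hlog := zero_le_one.trans (one_le_log_six_mul_div ht hδ)
  refine (one_sub_le_measureReal_windowsAccurate_sqLoss ht hB hδ hQ hy hM₀ hf₁ hf₂ hf₁M hf₂M hz
    hind).trans (measureReal_mono fun ω hω fhat hfhat => ?_)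
  have hrate {k} (hk : k ∈ Set.Icc 1 t) := hfhat.fast_rate hB hQ hyL2
    (memLp_two_of_abs_le hf₁ hf₁M) (memLp_two_of_abs_le hf₂ hf₂M) hM₀.le hδ hω hk
  constructor
  · refine le_mul_iInf_window (g := fun k => maxShift P Q t k + M₀ / √(windowSize B t k)) ht
      (by positivity) fun k hk => (hrate hk).1.trans ?_
    have hA : 0 ≤ maxShift P Q t k := maxShift_nonneg
    gcongr
    norm_num
  · rw [← sub_le_iff_le_add']
    exact le_mul_iInf_window (g := fun k => maxShift P Q t k ^ 2 + M₀ ^ 2 / windowSize B t k) ht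
      (by positivity) fun k hk => sub_le_iff_le_add'.2 (hrate hk).2
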